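/- Let $k\ge 6$ and $g=2d\ge 6$, and let $G$ be a finite $k$-regular graph of girth $g$ and excess $4$, that is, of order $n=2\left(1+(k-1)+\dots+(k-1)^{d-1}\right)+4$. Let $A$ be the adjacency matrix of $G$. Let $E$ be the excess matrix of $G$: its rows and columns are indexed by the vertices, and its entry at $(u,v)$ is $1$ if the distance of $u$ and $v$ in $G$ is $d+1$, and $0$ otherwise. Let $H_0(x)=1$, $H_1(x)=x$ and $H_{m+1}(x)=xH_m(x)-(k-1)H_{m-1}(x)$ for $m\ge1$ (the Dickson polynomials of the second kind with parameter $k-1$). Then $G$ is bipartite, and: 1) $E$ is the adjacency matrix of the graph $G(E)$ on the vertices of $G$ in which two vertices are adjacent if and only if their distance in $G$ is $d+1$, and $G(E)$ is a disjoint union of $c$ cycles $C_1,\dots,C_c$, of lengths $l_1,\dots,l_c\ge 3$. If $d$ is odd and $V_1,V_2$ are the partition sets of the bipartite graph $G$, then each cycle $C_i$ is completely contained in $V_1$ or in $V_2$. 2) The spectrum of $A$ (the eigenvalues listed with multiplicity) consists of 2.1) if $d$ is odd: $k$ and $-k$, $c-2$ (not necessarily distinct) solutions of $H_{d-1}(x)=-2$,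 and one solution of each equation $H_{d-1}(x)=-2\cos\left(\frac{2\pi j}{l_i}\right)$, $1\le j\le l_i-1$, $1\le i\le c$; 2.2) if $d$ is even: $k$ and $-k$, $c-1$ (not necessarily distinct) solutions of $H_{d-1}(x)=-2$, and one solution of each equation $H_{d-1}(x)=-2\cos\left(\frac{2\pi j}{l_i}\right)$, $1\le j\le l_i-1$, $1\le i\le c$, except for one pair $(i,j)$, for which $2j=l_i$ (so that the omitted equation is $H_{d-1}(x)=2$). In particular, the number of eigenvalues of $A$, counted with multiplicity, that satisfy $H_{d-1}(x)=-2$ is exactly $c-2$ if $d$ is odd and $c-1$ if $d$ is even. -/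

import Mathlib

namespace BipartiteExcess

/-- A `(k,g)`-graph: a `k`-regular graph of girth `g`. -/
structure IsKGGraph {V : Type*} [Fintype V] (G : SimpleGraph V) [DecidableRel G.Adj]
    (k g : ℕ) : Prop where
  regular : G.IsRegularOfDegree k
  girth_eq : G.egirth = (g : ℕ∞)

/-- The Moore bound `M(k,g)`, for `k ≥ 2` and `g ≥ 3`. -/
def mooreBound (k g : ℕ) : ℕ :=
  if Odd g then 1 + ∑ i ∈ Finset.range ((g - 3) / 2 + 1), k * (k - 1) ^ i
  else 2 * ∑ i ∈ Finset.range ((g - 2) / 2 + 1), (k - 1) ^ i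

/-- The excess `n - M(k,g)` of a `(k,g)`-graph of order `n`, as an integer. -/
def excess (V : Type*) [Fintype V] (k g : ℕ) : ℤ :=
  (Fintype.card V : ℤ) - (mooreBound k g : ℤ)

/-- The excess matrix `E = A_{d+1}`: the entry at `(u,v)` is `1` if the distance of `u` and `v` in
`G` is `d + 1`, and `0` otherwise. -/
noncomputable def excessMatrix {V : Type*} (G : SimpleGraph V) (d : ℕ) : Matrix V V ℝ :=
  Matrix.of fun u v => if G.dist u v = d + 1 then 1 else 0

/-- The excess graph `G(E)`: two vertices are adjacent if and only if their distance in `G` is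
`d + 1`. -/
def excessGraph {V : Type*} (G : SimpleGraph V) (d : ℕ) : SimpleGraph V where
  Adj u v := G.dist u v = d + 1
  symm := ⟨fun u v h => by rw [SimpleGraph.dist_comm]; exact h⟩
  loopless := ⟨fun u h => by simp at h⟩

noncomputable instance {V : Type*} (G : SimpleGraph V) (d : ℕ) : DecidableRel (excessGraph G d).Adj :=
  fun u v => inferInstanceAs (Decidable (G.dist u v = d + 1))

/-- The disjoint union of `c` cycles, the `i`-th one having length `l i` (for `l i ≥ 3`). -/
def cycleUnion {c : ℕ} (l : Fin c → ℕ) : SimpleGraph (Σ i : Fin c, Fin (l i)) where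
  Adj p q := ∃ (i : Fin c) (x y : Fin (l i)),
    p = ⟨i, x⟩ ∧ q = ⟨i, y⟩ ∧ (SimpleGraph.cycleGraph (l i)).Adj x y
  symm := ⟨fun _ _ ⟨i, x, y, hp, hq, h⟩ => ⟨i, y, x, hq, hp, h.symm⟩⟩
  loopless := ⟨fun p ⟨i, x, y, hp, hq, h⟩ => by
    subst hp
    simp only [Sigma.mk.injEq, heq_eq_eq, true_and] at hq
    exact h.ne hq⟩

/-- The polynomial `H_m` for valency `k`: the Dickson polynomial of the second kind with parameter
`k - 1` and degree `m`, so `H_0 = 1`, `H_1 = x` and `H_{m+2} = x H_{m+1} - (k-1) H_m`. -/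
noncomputable def H (k m : ℕ) : Polynomial ℝ :=
  Polynomial.dickson 2 ((k : ℝ) - 1) m

/-- The spectrum of a matrix: its eigenvalues, listed with their multiplicities. -/
noncomputable def spectrumOf {V : Type*} [Fintype V] [DecidableEq V] (A : Matrix V V ℝ) :
    Multiset ℝ :=
  A.charpoly.roots

/-- The pairs `(i, j)` with `1 ≤ i ≤ c` and `1 ≤ j ≤ l i - 1` (the cycles being numbered by
`Fin c`). -/
def cycleIndices {c : ℕ} (l : Fin c → ℕ) : Finset (Σ _ : Fin c, ℕ) :=
  Finset.univ.sigma fun i => Finset.Icc 1 (l i - 1)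

end BipartiteExcess

/-!
Since the girth is `2d`, for `m < d` the matrix `H_m(A)` is the `0/1`-matrix of the pairs of
vertices whose distance is at most `m` and has the parity of `m`. An edge `uv` has only `4`
vertices at distance at least `d` from both of its ends, fewer than the `k` neighbors of a vertex;
this excludes odd cycles and distances greater than `d + 1`. Consequently `H_{d-1}(A) + E` is the
`0/1`-matrix of the pairs of vertices whose distance has the parity of `d - 1`. It equals
`(J + (-1)^(d-1) s sᵀ) / 2`, where `J` is the all-ones matrix and `s` is the `±1`-vector of the
bipartition.

The all-ones vector and `s` are eigenvectors of `A` for `k` and `-k`. Hence every row sum of `E` is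
`2`, so that `G(E)` is a disjoint union of cycles, and `-H_{d-1}` maps the other eigenvalues of `A`
to what is left of the spectrum of `E` when one copy of `2` and one of `2 (-1)^(d-1)` are removed.
The eigenvalues of `E` are `2 cos(2πj / l_i)` for `0 ≤ j < l_i`, and exactly the `c` of them with
`j = 0` are equal to `2`.
-/

namespace BipartiteExcess

open SimpleGraph Matrix
open scoped Finset

section Walks

variable {V : Type*} {G : SimpleGraph V} {u v w x y : V} {a b d m n : ℕ}

lemma isAcyclic_fromEdgeSet_of_card_lt_egirth {s : Finset (Sym2 V)}
    (hs : (s : Set (Sym2 V)) ⊆ G.edgeSet) (hcard : (s.card : ℕ∞) < G.egirth) :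
    (fromEdgeSet (s : Set (Sym2 V))).IsAcyclic := by
  classical
  intro x c hc
  have hle : fromEdgeSet (s : Set (Sym2 V)) ≤ G := fun _ _ hxy => hs ((fromEdgeSet_adj _).1 hxy).1
  have hedges : c.edges.toFinset ⊆ s := fun e he => by
    have hmem := c.edges_subset_edgeSet (List.mem_toFinset.1 he)
    rw [edgeSet_fromEdgeSet] at hmem
    exact_mod_cast hmem.1
  have hlen : c.length ≤ s.card := by
    rw [← Walk.length_edges, ← List.toFinset_card_of_nodup hc.edges_nodup]
    exact Finset.card_le_card hedges
  have hgirth := egirth_le_length (hc.mapLe hle)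
  rw [Walk.length_map] at hgirth
  exact absurd (hcard.trans_le hgirth) (by exact_mod_cast hlen.not_gt)

lemma exists_isAcyclic_of_lt_egirth (p q : G.Walk u v)
    (h : ((p.length + q.length : ℕ) : ℕ∞) < G.egirth) :
    ∃ T : SimpleGraph V, T.IsAcyclic ∧ (∀ e ∈ p.edges, e ∈ T.edgeSet) ∧
      ∀ e ∈ q.edges, e ∈ T.edgeSet := by
  classical
  let s : Finset (Sym2 V) := p.edges.toFinset ∪ q.edges.toFinset
  have hs : (s : Set (Sym2 V)) ⊆ G.edgeSet := by
    intro e he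
    simp only [s, Finset.coe_union, List.coe_toFinset, Set.mem_union, Set.mem_ofPred_eq] at he
    exact he.elim (fun h => p.edges_subset_edgeSet h) fun h => q.edges_subset_edgeSet h
  have hcard : s.card ≤ p.length + q.length := by
    rw [← Walk.length_edges, ← Walk.length_edges]
    exact (Finset.card_union_le _ _).trans
      (add_le_add (List.toFinset_card_le _) (List.toFinset_card_le _))
  have hmem : ∀ e ∈ s, e ∈ (fromEdgeSet (s : Set (Sym2 V))).edgeSet := fun e he => by
    rw [edgeSet_fromEdgeSet]
    exact ⟨he, G.not_isDiag_of_mem_edgeSet (hs he)⟩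
  exact ⟨fromEdgeSet s,
    isAcyclic_fromEdgeSet_of_card_lt_egirth hs ((Nat.cast_le.2 hcard).trans_lt h),
    fun e he => hmem e (by simp [s, he]), fun e he => hmem e (by simp [s, he])⟩

lemma even_length_iff_of_lt_egirth (p q : G.Walk u v)
    (h : ((p.length + q.length : ℕ) : ℕ∞) < G.egirth) : Even p.length ↔ Even q.length := by
  obtain ⟨T, hT, hp, hq⟩ := exists_isAcyclic_of_lt_egirth p q h
  have C : T.Coloring Bool := hT.colorable_two.toColoring (by simp)
  rw [← Walk.length_transfer p hp, ← Walk.length_transfer q hq, C.even_length_iff_congr,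
    C.even_length_iff_congr]

lemma isPath_eq_of_lt_egirth {p q : G.Walk u v} (hp : p.IsPath) (hq : q.IsPath)
    (h : ((p.length + q.length : ℕ) : ℕ∞) < G.egirth) : p = q := by
  obtain ⟨T, hT, hpT, hqT⟩ := exists_isAcyclic_of_lt_egirth p q h
  have heq := (hT.subsingleton_path u v).elim ⟨_, hp.transfer hpT⟩ ⟨_, hq.transfer hqT⟩
  have hsupp := congrArg (fun r : T.Path u v => (r : T.Walk u v).support) heq
  simp only [Walk.support_transfer] at hsupp
  exact Walk.ext_support hsupp

lemma not_adj_of_common_neighbor (hg : 3 < G.egirth) (huv : G.Adj u v) (hvw : G.Adj v w) :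
    ¬ G.Adj u w := fun huw => by
  have := even_length_iff_of_lt_egirth huw.toWalk (hvw.toWalk.cons huv) (by simpa using hg)
  simp at this

lemma common_neighbor_unique (hg : 4 < G.egirth) (hxy : x ≠ y) (hxv : G.Adj x v)
    (hvy : G.Adj v y) (hxw : G.Adj x w) (hwy : G.Adj w y) : v = w := by
  have hpath : ∀ {z} (hxz : G.Adj x z) (hzy : G.Adj z y), (hzy.toWalk.cons hxz).IsPath := by
    intro z hxz hzy
    simp [hxz.ne, hzy.ne, hxy]
  have heq := isPath_eq_of_lt_egirth (hpath hxv hvy) (hpath hxw hwy) (by simpa using hg)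
  simpa using congrArg Walk.snd heq

/-- Two vertices are joined by a walk of length exactly `m`; backtracking is allowed. -/
def HasWalk (G : SimpleGraph V) (m : ℕ) (u v : V) : Prop := ∃ p : G.Walk u v, p.length = m

lemma hasWalk_zero : HasWalk G 0 u v ↔ u = v :=
  ⟨fun ⟨_, hp⟩ => Walk.eq_of_length_eq_zero hp, fun h => h ▸ ⟨Walk.nil, rfl⟩⟩

lemma hasWalk_one : HasWalk G 1 u v ↔ G.Adj u v :=
  ⟨fun ⟨_, hp⟩ => Walk.adj_of_length_eq_one hp, fun h => ⟨h.toWalk, by simp⟩⟩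

namespace HasWalk

lemma symm (h : HasWalk G m u v) : HasWalk G m v u :=
  h.imp' Walk.reverse fun p hp => by rw [Walk.length_reverse, hp]

lemma dist_le (h : HasWalk G m u v) : G.dist u v ≤ m := by
  obtain ⟨p, rfl⟩ := h
  exact SimpleGraph.dist_le p

lemma reachable (h : HasWalk G m u v) : G.Reachable u v := h.elim fun p _ => p.reachable

lemma concat (h : HasWalk G m u v) (hvw : G.Adj v w) : HasWalk G (m + 1) u w :=
  h.imp' (Walk.concat · hvw) fun p hp => by rw [Walk.length_concat, hp]

lemma cons (huv : G.Adj u v) (h : HasWalk G m v w) : HasWalk G (m + 1) u w :=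
  (h.symm.concat huv.symm).symm

lemma add_two_mul (h : HasWalk G m u v) (hvx : G.Adj v x) (j : ℕ) :
    HasWalk G (m + 2 * j) u v := by
  induction j with
  | zero => exact h
  | succ j ih => exact (ih.concat hvx).concat hvx.symm

lemma of_le_of_even_iff (h : HasWalk G m u v) (hvx : G.Adj v x) (hmn : m ≤ n)
    (hparity : Even m ↔ Even n) : HasWalk G n u v := by
  obtain ⟨j, hj⟩ := (Nat.even_sub hmn).2 hparity.symm
  obtain rfl : n = m + 2 * j := by omega
  exact h.add_two_mul hvx j

lemma even_iff (hg : ((2 * d : ℕ) : ℕ∞) ≤ G.egirth) (ha : HasWalk G a u v)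
    (hb : HasWalk G b u v) (hab : a + b < 2 * d) : Even a ↔ Even b := by
  obtain ⟨p, rfl⟩ := ha
  obtain ⟨q, rfl⟩ := hb
  exact even_length_iff_of_lt_egirth p q ((Nat.cast_lt.2 hab).trans_le hg)

end HasWalk

lemma hasWalk_succ : HasWalk G (m + 1) u v ↔ ∃ x, G.Adj x v ∧ HasWalk G m u x := by
  refine ⟨fun ⟨p, hp⟩ => ?_, fun ⟨x, hxv, hux⟩ => hux.concat hxv⟩
  have hnil : ¬ p.Nil := fun h => by
    rw [← Walk.length_eq_zero_iff] at h
    omega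
  exact ⟨p.penultimate, p.adj_penultimate hnil, p.dropLast, by simp [hp]⟩

/-- A non-path has a bypass that is shorter, hence shorter by at least two for parity reasons. -/
lemma hasWalk_of_not_isPath (hg : ((2 * d : ℕ) : ℕ∞) ≤ G.egirth) (hvx : G.Adj v x)
    {p : G.Walk u v} (hp : p.length = m + 2) (hm : m + 2 ≤ d) (hpath : ¬ p.IsPath) :
    HasWalk G m u v := by
  classical
  have hlt : p.bypass.length < p.length := by
    refine p.length_bypass_le_length.lt_of_ne fun h => hpath ?_
    rw [← p.bypass_eq_self_of_length_le_length_bypass h.ge]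
    exact p.bypass_isPath
  have hbypass : HasWalk G p.bypass.length u v := ⟨_, rfl⟩
  have hparity : Even p.bypass.length ↔ Even m := by
    rw [hbypass.even_iff hg ⟨p, rfl⟩ (by omega), hp]
    simp [parity_simps]
  refine hbypass.of_le_of_even_iff hvx ?_ hparity
  grind

lemma penultimate_unique (hg : ((2 * d : ℕ) : ℕ∞) ≤ G.egirth) (hm : m + 2 < d)
    (hno : ¬ HasWalk G m u v) (hx : G.Adj x v) (hy : G.Adj y v) (hux : HasWalk G (m + 1) u x)
    (huy : HasWalk G (m + 1) u y) : x = y := by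
  obtain ⟨p, hp⟩ := hux
  obtain ⟨q, hq⟩ := huy
  have hpath : ∀ {z : V} (hz : G.Adj z v) (r : G.Walk u z), r.length = m + 1 →
      (r.concat hz).IsPath := fun hz r hr => by
    by_contra hnot
    exact hno (hasWalk_of_not_isPath hg hz.symm (by simp [hr]) hm.le hnot)
  have hlen : (p.concat hx).length + (q.concat hy).length < 2 * d := by
    simp only [Walk.length_concat, hp, hq]
    omega
  have heq := isPath_eq_of_lt_egirth (hpath hx p hp) (hpath hy q hq)
    ((Nat.cast_lt.2 hlen).trans_le hg)
  simpa using congrArg Walk.penultimate heq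

end Walks

section Polynomials

open Polynomial

lemma H_zero (k : ℕ) : H k 0 = 1 := by
  norm_num [H]

lemma H_one (k : ℕ) : H k 1 = X := by
  simp [H]

lemma H_add_two (k m : ℕ) : H k (m + 2) = X * H k (m + 1) - C ((k : ℝ) - 1) * H k m :=
  dickson_add_two 2 _ m

lemma eval_H_valency (k m : ℕ) :
    (H k m).eval (k : ℝ) = ∑ i ∈ Finset.range (m + 1), ((k : ℝ) - 1) ^ i := by
  induction m using Nat.twoStepInduction with
  | zero => simp [H_zero]
  | one => simp [H_one, Finset.sum_range_succ]
  | more m ih₀ ih₁ =>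
    rw [H_add_two, eval_sub, eval_mul, eval_mul, eval_X, eval_C, ih₀, ih₁,
      Finset.sum_range_succ _ (m + 2), Finset.sum_range_succ _ (m + 1)]
    ring

lemma eval_H_neg (k m : ℕ) (x : ℝ) : (H k m).eval (-x) = (-1) ^ m * (H k m).eval x := by
  induction m using Nat.twoStepInduction with
  | zero => simp [H_zero]
  | one => simp [H_one]
  | more m ih₀ ih₁ =>
    rw [H_add_two, eval_sub, eval_sub, eval_mul, eval_mul, eval_mul, eval_mul, eval_X, eval_X,
      eval_C, eval_C, ih₀, ih₁]
    ring

lemma aeval_mulVec_of_mulVec_eq_smul {n K : Type*} [Fintype n] [DecidableEq n] [Field K]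
    {A : Matrix n n K} {x : n → K} {t : K} (h : A *ᵥ x = t • x) (p : K[X]) :
    aeval A p *ᵥ x = p.eval t • x := by
  rw [← toLin'_apply]
  change toLinAlgEquiv' (aeval A p) x = _
  rw [← aeval_algHom_apply]
  exact Module.End.aeval_apply_of_mem_apply_eq_smul (by simpa using h)

end Polynomials

section RegularCounting

variable {V : Type*} [Fintype V] {G : SimpleGraph V} [DecidableRel G.Adj] {k d m : ℕ}

lemma exists_adj_of_isRegularOfDegree (hreg : G.IsRegularOfDegree k) (hk : 0 < k) (v : V) :
    ∃ x, G.Adj v x := by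
  rwa [← G.degree_pos_iff_exists_adj v, hreg v]

lemma adjMatrix_mulVec_one (hreg : G.IsRegularOfDegree k) :
    G.adjMatrix ℝ *ᵥ 1 = (k : ℝ) • 1 := by
  ext v
  simpa using adjMatrix_mulVec_const_apply_of_regular (α := ℝ) (a := 1) hreg

open scoped Classical in
lemma card_penultimate (hreg : G.IsRegularOfDegree k) (hg : ((2 * d : ℕ) : ℕ∞) ≤ G.egirth)
    (hm : m + 2 < d) (u v : V) :
    #{x ∈ G.neighborFinset v | HasWalk G (m + 1) u x} =
      if HasWalk G m u v then k else if HasWalk G (m + 2) u v then 1 else 0 := by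
  split_ifs with hshort hlong
  · rw [Finset.filter_true_of_mem, card_neighborFinset_eq_degree, hreg v]
    exact fun x hx => hshort.concat ((mem_neighborFinset _ _ _).1 hx)
  · obtain ⟨x, hxv, hux⟩ := hasWalk_succ.1 hlong
    refine le_antisymm (Finset.card_le_one.2 fun y hy z hz => ?_)
      (Finset.card_pos.2 ⟨x, by simp [hxv.symm, hux]⟩)
    rw [Finset.mem_filter, mem_neighborFinset] at hy hz
    exact penultimate_unique hg hm hshort hy.1.symm hz.1.symm hy.2 hz.2
  · rw [Finset.card_eq_zero, Finset.filter_eq_empty_iff]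
    exact fun x hx hux => hlong (hux.concat ((mem_neighborFinset _ _ _).1 hx).symm)

open scoped Classical in
lemma aeval_H_apply [DecidableEq V] (hreg : G.IsRegularOfDegree k) (hk : 0 < k)
    (hg : ((2 * d : ℕ) : ℕ∞) ≤ G.egirth) (hm : m < d) (u v : V) :
    Polynomial.aeval (G.adjMatrix ℝ) (H k m) u v = if HasWalk G m u v then 1 else 0 := by
  induction m using Nat.twoStepInduction generalizing v with
  | zero => simp [H_zero, hasWalk_zero, Matrix.one_apply]
  | one => simp [H_one, hasWalk_one]
  | more m ih₀ ih₁ =>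
    obtain ⟨x, hvx⟩ := exists_adj_of_isRegularOfDegree hreg hk v
    rw [H_add_two, mul_comm Polynomial.X, map_sub, map_mul, map_mul, Polynomial.aeval_X,
      Polynomial.aeval_C, Matrix.sub_apply, mul_adjMatrix_apply, algebraMap_eq_diagonal,
      diagonal_mul, ih₀ (by omega), Finset.sum_congr rfl fun x _ => ih₁ (by omega) x,
      Finset.sum_boole, card_penultimate hreg hg hm]
    by_cases hshort : HasWalk G m u v
    · simp [hshort, show HasWalk G (m + 2) u v from hshort.add_two_mul hvx 1]
    · simp [hshort]

open scoped Classical in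
lemma card_filter_hasWalk (hreg : G.IsRegularOfDegree k) (hk : 0 < k)
    (hg : ((2 * d : ℕ) : ℕ∞) ≤ G.egirth) (hm : m < d) (u : V) :
    #{x | HasWalk G m u x} = ∑ i ∈ Finset.range (m + 1), (k - 1) ^ i := by
  have hrow := congrFun (aeval_mulVec_of_mulVec_eq_smul (adjMatrix_mulVec_one hreg) (H k m)) u
  simp only [mulVec, dotProduct, Pi.smul_apply, Pi.one_apply, smul_eq_mul, mul_one,
    aeval_H_apply hreg hk hg hm, Finset.sum_boole, eval_H_valency] at hrow
  rify [Nat.cast_sub (show 1 ≤ k from hk)]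
  exact hrow

open scoped Classical in
/-- Compare the entries at `(u, w)` of `A * H_m(A)` and `H_m(A) * A`. -/
lemma card_filter_hasWalk_comm (hreg : G.IsRegularOfDegree k) (hk : 0 < k)
    (hg : ((2 * d : ℕ) : ℕ∞) ≤ G.egirth) (hm : m < d) (u w : V) :
    #{v ∈ G.neighborFinset u | HasWalk G m v w} = #{x ∈ G.neighborFinset w | HasWalk G m u x} := by
  have hcomm : Commute (G.adjMatrix ℝ) (Polynomial.aeval (G.adjMatrix ℝ) (H k m)) := by
    simpa using (Commute.all Polynomial.X (H k m)).map (Polynomial.aeval (G.adjMatrix ℝ))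
  have hentry := congrFun (congrFun hcomm.eq u) w
  simp only [mul_adjMatrix_apply, adjMatrix_mul_apply, aeval_H_apply hreg hk hg hm] at hentry
  rw [Finset.sum_boole, Finset.sum_boole] at hentry
  exact_mod_cast hentry

end RegularCounting

lemma mooreBound_two_mul {d : ℕ} (k : ℕ) (hd : 0 < d) :
    mooreBound k (2 * d) = 2 * ∑ i ∈ Finset.range d, (k - 1) ^ i := by
  rw [mooreBound, if_neg (by simp), show (2 * d - 2) / 2 + 1 = d by omega]

lemma dist_le_dist_add_one_of_adj {V : Type*} {G : SimpleGraph V} {v w : V} (hvw : G.Adj v w)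
    (u : V) : G.dist u w ≤ G.dist u v + 1 := by
  rcases hvw.diff_dist_adj (u := u) with h | h | h <;> omega

lemma dist_le_dist_add_one_of_adj_left {V : Type*} {G : SimpleGraph V} {u v : V}
    (huv : G.Adj u v) (w : V) : G.dist u w ≤ G.dist v w + 1 := by
  rw [G.dist_comm, G.dist_comm (v := w)]
  exact dist_le_dist_add_one_of_adj huv.symm w

/-- A `(k, 2d)`-graph whose excess `e` is at most `k - 2`: the range in which the excess is too
small to destroy bipartiteness. -/
structure HasSmallExcess {V : Type*} [Fintype V] (G : SimpleGraph V) [DecidableRel G.Adj]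
    (k d e : ℕ) : Prop extends IsKGGraph G k (2 * d) where
  excess_eq : excess V k (2 * d) = e
  three_le : 3 ≤ d
  add_two_le : e + 2 ≤ k

/-- The vertices at distance at least `d` from both `u` and `v`. For adjacent `u` and `v` these are
the vertices outside the Moore tree rooted at the edge `uv`, and the excess is their number. -/
noncomputable def excessVertices {V : Type*} [Fintype V] (G : SimpleGraph V) (d : ℕ) (u v : V) :
    Finset V :=
  {x | d ≤ G.dist u x ∧ d ≤ G.dist v x}

lemma mem_excessVertices {V : Type*} [Fintype V] {G : SimpleGraph V} {d : ℕ} {u v x : V} :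
    x ∈ excessVertices G d u v ↔ d ≤ G.dist u x ∧ d ≤ G.dist v x := by
  simp [excessVertices]

namespace HasSmallExcess

variable {V : Type*} [Fintype V] {G : SimpleGraph V} [DecidableRel G.Adj] {k d e m : ℕ}
  (h : HasSmallExcess G k d e) {u v w x : V}

include h

lemma valency_pos : 0 < k := (Nat.succ_pos _).trans_le h.add_two_le

lemma le_egirth : ((2 * d : ℕ) : ℕ∞) ≤ G.egirth := h.girth_eq.ge

lemma four_lt_egirth : 4 < G.egirth := by
  rw [h.girth_eq]
  have := h.three_le
  exact_mod_cast (by omega : 4 < 2 * d)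

lemma exists_adj (v : V) : ∃ x, G.Adj v x :=
  exists_adj_of_isRegularOfDegree h.regular h.valency_pos v

lemma card_eq : Fintype.card V = 2 * ∑ i ∈ Finset.range d, (k - 1) ^ i + e := by
  have hd := h.three_le
  have hexcess := h.excess_eq
  rw [excess, mooreBound_two_mul k (by omega)] at hexcess
  omega

lemma eval_H_valency_eq :
    (H k (d - 1)).eval (k : ℝ) = ((∑ i ∈ Finset.range d, (k - 1) ^ i : ℕ) : ℝ) := by
  have hd := h.three_le
  rw [eval_H_valency, Nat.sub_add_cancel (by omega)]
  push_cast [Nat.cast_sub (show 1 ≤ k from h.valency_pos)]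
  rfl

open scoped Classical in
lemma card_compl_hasWalk (huv : G.Adj u v) :
    #{x | ¬ HasWalk G (d - 1) u x ∧ ¬ HasWalk G (d - 1) v x} = e := by
  have hd := h.three_le
  have hcount (u) : #{x | HasWalk G (d - 1) u x} = ∑ i ∈ Finset.range d, (k - 1) ^ i := by
    rw [card_filter_hasWalk h.regular h.valency_pos h.le_egirth (by omega) u,
      Nat.sub_add_cancel (by omega)]
  have hdisj : Disjoint ({x | HasWalk G (d - 1) u x} : Finset V)
      ({x | HasWalk G (d - 1) v x} : Finset V) := by
    refine Finset.disjoint_filter.2 fun x _ hu hv => ?_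
    have hparity := (HasWalk.cons huv hv).even_iff h.le_egirth hu (by omega)
    rw [Nat.even_add_one] at hparity
    tauto
  have hcompl : ({x | ¬ HasWalk G (d - 1) u x ∧ ¬ HasWalk G (d - 1) v x} : Finset V) =
      (({x | HasWalk G (d - 1) u x} : Finset V) ∪ ({x | HasWalk G (d - 1) v x} : Finset V))ᶜ := by
    ext x
    simp
  rw [hcompl, Finset.card_compl, Finset.card_union_of_disjoint hdisj, hcount, hcount, h.card_eq]
  omega

/-- A vertex not reachable from `u`, together with its `k` neighbors, would exceed the excess. -/
lemma connected : G.Connected := by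
  classical
  have : Nonempty V := by
    rw [← Fintype.card_pos_iff, h.card_eq]
    have hd := h.three_le
    have := Finset.single_le_sum (f := fun i => (k - 1) ^ i) (fun _ _ => Nat.zero_le _)
      (Finset.mem_range.2 (show 0 < d by omega))
    simp only [pow_zero] at this
    omega
  refine ⟨fun u w => by_contra fun hunreachable => ?_⟩
  obtain ⟨v, huv⟩ := h.exists_adj u
  have hsub : insert w (G.neighborFinset w) ⊆
      ({x | ¬ HasWalk G (d - 1) u x ∧ ¬ HasWalk G (d - 1) v x} : Finset V) := by
    intro x hx
    have hxw : G.Reachable x w := by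
      rcases Finset.mem_insert.1 hx with rfl | hx
      · rfl
      · exact ((mem_neighborFinset _ _ _).1 hx).reachable.symm
    simp only [Finset.mem_filter_univ]
    exact ⟨fun hux => hunreachable (hux.reachable.trans hxw),
      fun hvx => hunreachable (huv.reachable.trans (hvx.reachable.trans hxw))⟩
  have hcard := Finset.card_le_card hsub
  rw [h.card_compl_hasWalk huv, Finset.card_insert_of_notMem (by simp),
    card_neighborFinset_eq_degree, h.regular w] at hcard
  have := h.add_two_le
  omega

lemma hasWalk_dist (u v : V) : HasWalk G (G.dist u v) u v :=
  h.connected.exists_walk_length_eq_dist u v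

lemma hasWalk_iff (hm : m < d) :
    HasWalk G m u v ↔ G.dist u v ≤ m ∧ (Even (G.dist u v) ↔ Even m) := by
  refine ⟨fun huv => ⟨huv.dist_le, ?_⟩, fun ⟨hle, hparity⟩ => ?_⟩
  · have := huv.dist_le
    exact (h.hasWalk_dist u v).even_iff h.le_egirth huv (by omega)
  · obtain ⟨x, hvx⟩ := h.exists_adj v
    exact (h.hasWalk_dist u v).of_le_of_even_iff hvx hle hparity

lemma dist_ne_of_adj (hvw : G.Adj v w) (hd : G.dist u v < d) : G.dist u w ≠ G.dist u v := by
  intro heq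
  have hparity := (h.hasWalk_dist u w).even_iff h.le_egirth ((h.hasWalk_dist u v).concat hvw)
    (by omega)
  rw [heq, Nat.even_add_one] at hparity
  tauto

lemma dist_ne_of_adj_left (huv : G.Adj u v) (hd : G.dist u w < d) : G.dist v w ≠ G.dist u w := by
  rw [G.dist_comm, G.dist_comm (u := u)] at *
  exact h.dist_ne_of_adj huv hd

lemma hasWalk_pred_iff_of_adj (huv : G.Adj u v) (hv : d ≤ G.dist v x) :
    HasWalk G (d - 1) u x ↔ G.dist u x = d - 1 := by
  have hd := h.three_le
  have := dist_le_dist_add_one_of_adj_left huv.symm x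
  rw [h.hasWalk_iff (by omega)]
  exact ⟨fun hux => by omega, fun hux => by rw [hux]; simp⟩

/-- If `u` is at distance less than `d` from `x`, then its distance or that of its neighbor `v` has
the parity of `d - 1`, and a shortest walk can be prolonged to length `d - 1`. -/
lemma hasWalk_pred_or_of_dist_lt (huv : G.Adj u v) (hux : G.dist u x < d) :
    HasWalk G (d - 1) u x ∨ HasWalk G (d - 1) v x := by
  have hd := h.three_le
  by_cases hparity : Even (G.dist u x) ↔ Even (d - 1)
  · exact .inl ((h.hasWalk_iff (by omega)).2 ⟨by omega, hparity⟩)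
  · have hne : G.dist u x ≠ d - 1 := fun heq => hparity (by rw [heq])
    obtain ⟨y, hxy⟩ := h.exists_adj x
    refine .inr (((HasWalk.cons huv.symm (h.hasWalk_dist u x)).of_le_of_even_iff hxy (by omega) ?_))
    rw [Nat.even_add_one]
    tauto

lemma card_excessVertices (huv : G.Adj u v) : #(excessVertices G d u v) = e := by
  classical
  have hd := h.three_le
  rw [← h.card_compl_hasWalk huv]
  congr 1
  ext x
  rw [mem_excessVertices, Finset.mem_filter_univ]
  refine ⟨fun ⟨_, _⟩ => ⟨fun hw => ?_, fun hw => ?_⟩, fun ⟨hu, hv⟩ => ⟨?_, ?_⟩⟩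
  · have := hw.dist_le
    omega
  · have := hw.dist_le
    omega
  · by_contra! hlt
    exact (h.hasWalk_pred_or_of_dist_lt huv hlt).elim hu hv
  · by_contra! hlt
    exact (h.hasWalk_pred_or_of_dist_lt huv.symm hlt).elim hv hu

end HasSmallExcess

section GeodesicNeighbors

variable {V : Type*} [Fintype V] {G : SimpleGraph V} [DecidableRel G.Adj] {u v w x z : V}

/-- The neighbors of `u` that are second vertices of geodesics from `u` to `w`. -/
noncomputable def geodesicNeighbors (G : SimpleGraph V) [DecidableRel G.Adj] (u w : V) : Finset V :=
  {v ∈ G.neighborFinset u | G.dist v w < G.dist u w}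

/-- The neighbors of `w` that are not closer to `u` than `w` is. -/
noncomputable def outerNeighbors (G : SimpleGraph V) [DecidableRel G.Adj] (u w : V) : Finset V :=
  {z ∈ G.neighborFinset w | G.dist u w ≤ G.dist u z}

lemma mem_geodesicNeighbors :
    v ∈ geodesicNeighbors G u w ↔ G.Adj u v ∧ G.dist v w < G.dist u w := by
  simp [geodesicNeighbors]

lemma mem_outerNeighbors : z ∈ outerNeighbors G u w ↔ G.Adj w z ∧ G.dist u w ≤ G.dist u z := by
  simp [outerNeighbors]

lemma card_geodesicNeighbors_add_card_outerNeighbors (u w : V) :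
    #(geodesicNeighbors G w u) + #(outerNeighbors G u w) = G.degree w := by
  have hfilter : outerNeighbors G u w =
      {z ∈ G.neighborFinset w | ¬ G.dist z u < G.dist w u} :=
    Finset.filter_congr fun z _ => by rw [not_lt, G.dist_comm, G.dist_comm (u := u)]
  rw [hfilter, geodesicNeighbors, Finset.card_filter_add_card_filter_not,
    card_neighborFinset_eq_degree]

/-- Distinct neighbors of `x` have distinct companions: a common one would close a triangle or a
quadrilateral. -/
lemma degree_lt_card_of_forall_adj (hg : 4 < G.egirth) {X : Finset V} (hx : x ∈ X)
    (hX : ∀ z, G.Adj x z → ∃ y ∈ X, y ≠ x ∧ (y = z ∨ G.Adj z y)) : G.degree x < #X := by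
  classical
  choose! f hfX hfx hf using hX
  have hinj : Set.InjOn f (G.neighborFinset x) := by
    intro z hz z' hz' heq
    rw [Finset.mem_coe, mem_neighborFinset] at hz hz'
    have hg₃ : 3 < G.egirth := lt_trans (by norm_num) hg
    have hz'f := hf z' hz'
    rw [← heq] at hz'f
    rcases hf z hz with hfz | hfz <;> rcases hz'f with hfz' | hfz'
    · exact hfz.symm.trans hfz'
    · exact (not_adj_of_common_neighbor hg₃ hz' (hfz ▸ hfz') hz).elim
    · exact (not_adj_of_common_neighbor hg₃ hz (hfz' ▸ hfz) hz').elim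
    · exact common_neighbor_unique hg (hfx z hz).symm hz hfz hz' hfz'
  have hmaps : ∀ z ∈ G.neighborFinset x, f z ∈ X.erase x := fun z hz => by
    rw [mem_neighborFinset] at hz
    exact Finset.mem_erase.2 ⟨hfx z hz, hfX z hz⟩
  rw [← card_neighborFinset_eq_degree]
  exact (Finset.card_le_card_of_injOn f hmaps hinj).trans_lt (Finset.card_erase_lt_of_mem hx)

end GeodesicNeighbors

namespace HasSmallExcess

variable {V : Type*} [Fintype V] {G : SimpleGraph V} [DecidableRel G.Adj] {k d e : ℕ}
  (h : HasSmallExcess G k d e) {u v w x z : V}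

include h

lemma exists_mem_geodesicNeighbors (huw : u ≠ w) : ∃ v, v ∈ geodesicNeighbors G u w := by
  have hpos := h.connected.pos_dist_of_ne huw.symm
  have hwalk := h.hasWalk_dist w u
  rw [← Nat.sub_add_cancel hpos] at hwalk
  obtain ⟨v, hvu, hwv⟩ := hasWalk_succ.1 hwalk
  refine ⟨v, mem_geodesicNeighbors.2 ⟨hvu.symm, ?_⟩⟩
  have := hwv.dist_le
  rw [G.dist_comm, G.dist_comm (u := u)]
  omega

lemma card_geodesicNeighbors_comm (huw : G.dist u w = d) :
    #(geodesicNeighbors G u w) = #(geodesicNeighbors G w u) := by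
  classical
  have hd := h.three_le
  have hwu : G.dist w u = d := G.dist_comm.trans huw
  have hgeodesic {u w : V} (huw : G.dist u w = d) :
      geodesicNeighbors G u w = {v ∈ G.neighborFinset u | HasWalk G (d - 1) v w} :=
    Finset.filter_congr fun v hv => by
      rw [mem_neighborFinset] at hv
      have := dist_le_dist_add_one_of_adj_left hv w
      rw [h.hasWalk_pred_iff_of_adj hv.symm huw.ge]
      omega
  have hsymm : ({v ∈ G.neighborFinset w | HasWalk G (d - 1) v u} : Finset V) =
      {v ∈ G.neighborFinset w | HasWalk G (d - 1) u v} :=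
    Finset.filter_congr fun v _ => ⟨HasWalk.symm, HasWalk.symm⟩
  rw [hgeodesic huw, hgeodesic hwu, hsymm]
  exact card_filter_hasWalk_comm h.regular h.valency_pos h.le_egirth (by omega) u w

lemma card_geodesicNeighbors_add_card_outerNeighbors (huw : G.dist u w = d) :
    #(geodesicNeighbors G u w) + #(outerNeighbors G u w) = k := by
  rw [h.card_geodesicNeighbors_comm huw,
    BipartiteExcess.card_geodesicNeighbors_add_card_outerNeighbors, h.regular w]

lemma outerNeighbors_subset_excessVertices (huw : G.dist u w = d)
    (hv : v ∈ geodesicNeighbors G u w) : outerNeighbors G u w ⊆ excessVertices G d u v := by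
  intro z hz
  obtain ⟨huv, hvw⟩ := mem_geodesicNeighbors.1 hv
  obtain ⟨hwz, huz⟩ := mem_outerNeighbors.1 hz
  have := h.dist_ne_of_adj hwz (by omega : G.dist v w < d)
  have := dist_le_dist_add_one_of_adj_left huv w
  have := dist_le_dist_add_one_of_adj_left huv z
  exact mem_excessVertices.2 ⟨by omega, by omega⟩

lemma two_le_card_geodesicNeighbors (huw : G.dist u w = d) : 2 ≤ #(geodesicNeighbors G u w) := by
  have hd := h.three_le
  have hne : u ≠ w := by
    rintro rfl
    rw [dist_self] at huw
    omega
  obtain ⟨v, hv⟩ := h.exists_mem_geodesicNeighbors hne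
  have hcard := Finset.card_le_card (h.outerNeighbors_subset_excessVertices huw hv)
  rw [h.card_excessVertices (mem_geodesicNeighbors.1 hv).1] at hcard
  have := h.card_geodesicNeighbors_add_card_outerNeighbors huw
  have := h.add_two_le
  omega

lemma exists_mem_outerNeighbors_ne (huz : G.dist u z = d) (hux : G.dist u x = d)
    (hdisj : Disjoint (geodesicNeighbors G u z) (geodesicNeighbors G u x)) (w : V) :
    ∃ y ∈ outerNeighbors G u z, y ≠ w := by
  classical
  have hsub : geodesicNeighbors G u z ∪ geodesicNeighbors G u x ⊆ G.neighborFinset u :=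
    Finset.union_subset (Finset.filter_subset _ _) (Finset.filter_subset _ _)
  have hcard := Finset.card_le_card hsub
  rw [Finset.card_union_of_disjoint hdisj, card_neighborFinset_eq_degree, h.regular u] at hcard
  have := h.two_le_card_geodesicNeighbors hux
  have := h.card_geodesicNeighbors_add_card_outerNeighbors huz
  exact Finset.exists_mem_ne (by omega) w

lemma disjoint_geodesicNeighbors_of_adj (huz : G.dist u z = d) (hux : G.dist u x = d)
    (hzx : G.Adj z x) : Disjoint (geodesicNeighbors G u z) (geodesicNeighbors G u x) := by
  refine Finset.disjoint_left.2 fun v hvz hvx => ?_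
  obtain ⟨huv, hvz⟩ := mem_geodesicNeighbors.1 hvz
  obtain ⟨-, hvx⟩ := mem_geodesicNeighbors.1 hvx
  have := dist_le_dist_add_one_of_adj_left huv z
  have := dist_le_dist_add_one_of_adj_left huv x
  exact h.dist_ne_of_adj hzx (by omega) (by omega : G.dist v x = G.dist v z)

lemma exists_adj_excessVertices (huv : G.Adj u v) (hux : G.dist u x = d) (hvx : d ≤ G.dist v x)
    (hxz : G.Adj x z) (hvz : G.dist v z < d) :
    ∃ y ∈ excessVertices G d u v, y ≠ x ∧ G.Adj z y := by
  have := dist_le_dist_add_one_of_adj hxz.symm v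
  have := dist_le_dist_add_one_of_adj hxz.symm u
  have := dist_le_dist_add_one_of_adj_left huv z
  have := h.dist_ne_of_adj_left huv.symm hvz
  have huz : G.dist u z = d := by omega
  obtain ⟨y, hy, hyx⟩ := h.exists_mem_outerNeighbors_ne huz hux
    (h.disjoint_geodesicNeighbors_of_adj huz hux hxz.symm) x
  have hv : v ∈ geodesicNeighbors G u z := mem_geodesicNeighbors.2 ⟨huv, by omega⟩
  exact ⟨y, h.outerNeighbors_subset_excessVertices huz hv hy, hyx, (mem_outerNeighbors.1 hy).1⟩

/-- Otherwise the `e < k` excess vertices of the edge `uv` would contain `x` and a companion of each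
of the `k` neighbors of `x`. -/
lemma dist_ne_of_adj_of_dist_eq (huv : G.Adj u v) (hux : G.dist u x = d) : G.dist v x ≠ d := by
  intro hvx
  have hlt : G.degree x < #(excessVertices G d u v) := by
    refine degree_lt_card_of_forall_adj h.four_lt_egirth
      (mem_excessVertices.2 ⟨hux.ge, hvx.ge⟩) fun z hxz => ?_
    rcases lt_or_ge (G.dist v z) d with hvz | hvz
    · obtain ⟨y, hy, hyx, hzy⟩ := h.exists_adj_excessVertices huv hux hvx.ge hxz hvz
      exact ⟨y, hy, hyx, .inr hzy⟩
    rcases lt_or_ge (G.dist u z) d with huz | huz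
    · obtain ⟨y, hy, hyx, hzy⟩ := h.exists_adj_excessVertices huv.symm hvx hux.ge hxz huz
      exact ⟨y, mem_excessVertices.2 (mem_excessVertices.1 hy).symm, hyx, .inr hzy⟩
    · exact ⟨z, mem_excessVertices.2 ⟨huz, hvz⟩, hxz.ne', .inl rfl⟩
  rw [h.regular x, h.card_excessVertices huv] at hlt
  have := h.add_two_le
  omega

lemma dist_ne_of_adj_of_dist_eq_right (hvw : G.Adj v w) (huv : G.dist u v = d) :
    G.dist u w ≠ d := by
  rw [G.dist_comm] at huv ⊢
  exact h.dist_ne_of_adj_of_dist_eq hvw huv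

lemma card_filter_lt_dist_le (u : V) : #{x | d < G.dist u x} ≤ e := by
  obtain ⟨v, huv⟩ := h.exists_adj u
  rw [← h.card_excessVertices huv]
  refine Finset.card_le_card fun x hx => ?_
  rw [Finset.mem_filter_univ] at hx
  have := dist_le_dist_add_one_of_adj_left huv x
  exact mem_excessVertices.2 ⟨by omega, by omega⟩

lemma exists_adj_dist_eq (hux : d < G.dist u x) : ∃ y, G.Adj x y ∧ G.dist u y = d := by
  by_contra! hne
  have hsub : G.neighborFinset x ⊆ ({y | d < G.dist u y} : Finset V) := fun y hy => by
    rw [mem_neighborFinset] at hy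
    have := hne y hy
    have := dist_le_dist_add_one_of_adj hy.symm u
    rw [Finset.mem_filter_univ]
    omega
  have hcard := (Finset.card_le_card hsub).trans (h.card_filter_lt_dist_le u)
  rw [card_neighborFinset_eq_degree, h.regular x] at hcard
  have := h.add_two_le
  omega

/-- A common second vertex `v` would be at distance `d` from both ends of the edge `wx`. -/
lemma disjoint_geodesicNeighbors_of_lt_dist {y : V} (huw : d < G.dist u w) (hux : d < G.dist u x)
    (hwx : G.Adj w x) (hwz : G.Adj w z) (huz : G.dist u z = d) (hxy : G.Adj x y)
    (huy : G.dist u y = d) : Disjoint (geodesicNeighbors G u z) (geodesicNeighbors G u y) := by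
  refine Finset.disjoint_left.2 fun v hvz hvy => ?_
  obtain ⟨huv, hvz⟩ := mem_geodesicNeighbors.1 hvz
  obtain ⟨-, hvy⟩ := mem_geodesicNeighbors.1 hvy
  have := dist_le_dist_add_one_of_adj_left huv w
  have := dist_le_dist_add_one_of_adj_left huv x
  have := dist_le_dist_add_one_of_adj hwz.symm v
  have := dist_le_dist_add_one_of_adj hxy.symm v
  exact h.dist_ne_of_adj_of_dist_eq_right hwx (by omega : G.dist v w = d) (by omega)

/-- Otherwise the fewer than `k` vertices at distance greater than `d` from `u` would contain `w`
and a companion of each of the `k` neighbors of `w`. -/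
lemma dist_le_of_lt_dist_of_adj (huw : d < G.dist u w) (hwx : G.Adj w x) : G.dist u x ≤ d := by
  by_contra! hux
  obtain ⟨y', hxy', huy'⟩ := h.exists_adj_dist_eq hux
  have hlt : G.degree w < #{x | d < G.dist u x} := by
    refine degree_lt_card_of_forall_adj h.four_lt_egirth (by simpa using huw) fun z hwz => ?_
    rcases lt_or_ge d (G.dist u z) with huz | huz
    · exact ⟨z, by simpa using huz, hwz.ne', .inl rfl⟩
    have := dist_le_dist_add_one_of_adj hwz.symm u
    have huz : G.dist u z = d := by omega
    obtain ⟨y, hy, hyw⟩ := h.exists_mem_outerNeighbors_ne huz huy'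
      (h.disjoint_geodesicNeighbors_of_lt_dist huw hux hwx hwz huz hxy' huy') w
    obtain ⟨hzy, huy⟩ := mem_outerNeighbors.1 hy
    have := h.dist_ne_of_adj_of_dist_eq_right hzy huz
    exact ⟨y, by rw [Finset.mem_filter_univ]; omega, hyw, .inr hzy⟩
  have := hlt.trans_le (h.card_filter_lt_dist_le u)
  rw [h.regular w] at this
  have := h.add_two_le
  omega

lemma dist_le_add_one (u w : V) : G.dist u w ≤ d + 1 := by
  by_contra! hlt
  obtain ⟨x, hwx, huy⟩ := h.exists_adj_dist_eq (by omega : d < G.dist u w)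
  have := dist_le_dist_add_one_of_adj hwx.symm u
  omega

lemma isBipartite : G.IsBipartite := by
  obtain ⟨u⟩ := h.connected.nonempty
  refine (Coloring.mk (fun v => decide (Even (G.dist u v))) fun {v w} hvw hcolor => ?_).colorable
  have hne : G.dist u w ≠ G.dist u v := by
    rcases lt_trichotomy (G.dist u v) d with hlt | heq | hgt
    · exact h.dist_ne_of_adj hvw hlt
    · rw [heq]
      exact h.dist_ne_of_adj_of_dist_eq_right hvw heq
    · exact ((h.dist_le_of_lt_dist_of_adj hgt hvw).trans_lt hgt).ne
  have := dist_le_dist_add_one_of_adj hvw u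
  have := dist_le_dist_add_one_of_adj hvw.symm u
  rw [decide_eq_decide] at hcolor
  grind

end HasSmallExcess

section Charpoly

open Polynomial

variable {n R : Type*} [Fintype n] [DecidableEq n]

lemma mem_roots_charpoly_of_mulVec_eq_smul [CommRing R] [IsDomain R] {A : Matrix n n R} {v : n → R}
    {t : R} (hv : v ≠ 0) (h : A *ᵥ v = t • v) : t ∈ A.charpoly.roots := by
  rw [mem_roots (charpoly_monic A).ne_zero, IsRoot, eval_charpoly]
  refine exists_mulVec_eq_zero_iff.1 ⟨v, hv, ?_⟩
  rw [sub_mulVec, h]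
  simp [diagonal_const_mulVec]

lemma roots_charpoly_aeval {A : Matrix n n ℝ} (hA : A.IsHermitian) (p : ℝ[X]) :
    (aeval A p).charpoly.roots = A.charpoly.roots.map fun x => p.eval x := by
  rw [← cfc_polynomial p A hA.isSelfAdjoint, hA.charpoly_cfc_eq, hA.roots_charpoly_eq_eigenvalues,
    Multiset.map_map, roots_prod _ _ (by simp [Finset.prod_ne_zero_iff, X_sub_C_ne_zero])]
  simp

variable [CommRing R] [IsDomain R]

lemma charpoly_add_vecMulVec_of_mulVec_eq_zero {M : Matrix n n R} {v : n → R} (w : n → R)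
    (hv : M *ᵥ v = 0) :
    (M + vecMulVec v w).charpoly * X = M.charpoly * (X - C (v ⬝ᵥ w)) := by
  rcases isEmpty_or_nonempty n with hn | hn
  · simp
  have hfactor : M.charmatrix * (vecMulVec v w).charmatrix =
      (X : R[X]) • (M + vecMulVec v w).charmatrix := by
    have hzero : C.mapMatrix M * C.mapMatrix (vecMulVec v w) = 0 := by
      rw [← map_mul, mul_vecMulVec, hv, zero_vecMulVec, map_zero]
    simp only [charmatrix, map_add, sub_mul, mul_sub, hzero, ← smul_one_eq_diagonal,
      scalar_apply, smul_mul_assoc, mul_smul_comm, one_mul, mul_one, smul_sub, smul_add]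
    abel
  have hdet := congrArg det hfactor
  rw [det_mul, det_smul] at hdet
  change M.charpoly * (vecMulVec v w).charpoly = _ * (M + vecMulVec v w).charpoly at hdet
  rw [charpoly_vecMulVec] at hdet
  have hpow : (X : R[X]) ^ Fintype.card n = X ^ (Fintype.card n - 1) * X := by
    rw [← pow_succ, Nat.sub_add_cancel Fintype.card_pos]
  rw [hpow, smul_eq_C_mul] at hdet
  refine mul_left_cancel₀ (pow_ne_zero (Fintype.card n - 1) (X_ne_zero (R := R))) ?_
  linear_combination -hdet

lemma charpoly_add_vecMulVec_of_mulVec_eq_smul {M : Matrix n n R} {v : n → R} {t : R} (w : n → R)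
    (hv : M *ᵥ v = t • v) :
    (M + vecMulVec v w).charpoly * (X - C t) = M.charpoly * (X - C (t + v ⬝ᵥ w)) := by
  have hshift := charpoly_add_vecMulVec_of_mulVec_eq_zero (M := M - scalar n t) (v := v) w
    (by simp [sub_mulVec, hv, diagonal_const_mulVec])
  rw [sub_add_eq_add_sub, charpoly_sub_scalar, charpoly_sub_scalar] at hshift
  have hcomp := congrArg (fun p => p.comp (X - C t)) hshift
  simp only [mul_comp, comp_assoc] at hcomp
  simpa [sub_sub] using hcomp

lemma roots_charpoly_add_vecMulVec {M : Matrix n n R} {v : n → R} {t : R} {N : Multiset R}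
    (w : n → R) (hv : M *ᵥ v = t • v) (hM : M.charpoly.roots = t ::ₘ N) :
    (M + vecMulVec v w).charpoly.roots = (t + v ⬝ᵥ w) ::ₘ N := by
  have hroots := congrArg roots (charpoly_add_vecMulVec_of_mulVec_eq_smul w hv)
  rw [roots_mul (mul_ne_zero (charpoly_monic _).ne_zero (X_sub_C_ne_zero _)),
    roots_mul (mul_ne_zero (charpoly_monic _).ne_zero (X_sub_C_ne_zero _)), roots_X_sub_C,
    roots_X_sub_C, hM, add_comm, add_comm (t ::ₘ N), Multiset.singleton_add,
    Multiset.singleton_add, Multiset.cons_swap] at hroots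
  exact (Multiset.cons_inj_right t).1 hroots

lemma roots_charpoly_add_vecMulVec_add_vecMulVec {M : Matrix n n R} {v₁ v₂ w₁ : n → R} {t₁ t₂ : R}
    {N : Multiset R} (w₂ : n → R) (hv₁ : M *ᵥ v₁ = t₁ • v₁) (hv₂ : M *ᵥ v₂ = t₂ • v₂)
    (horth : w₁ ⬝ᵥ v₂ = 0) (hM : M.charpoly.roots = t₁ ::ₘ t₂ ::ₘ N) :
    (M + vecMulVec v₁ w₁ + vecMulVec v₂ w₂).charpoly.roots =
      (t₁ + v₁ ⬝ᵥ w₁) ::ₘ (t₂ + v₂ ⬝ᵥ w₂) ::ₘ N := by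
  rw [Multiset.cons_swap]
  refine roots_charpoly_add_vecMulVec w₂ ?_ ?_
  · rw [add_mulVec, hv₂, vecMulVec_mulVec, horth]
    simp
  · rw [roots_charpoly_add_vecMulVec w₁ hv₁ hM, Multiset.cons_swap]

end Charpoly

section ParitySign

variable {V : Type*} {G : SimpleGraph V}

/-- The `±1`-vector that is constant on each partition set of a connected bipartite graph `G`,
normalized to be `1` at the vertex `r`. -/
noncomputable def paritySign (G : SimpleGraph V) (r v : V) : ℝ := (-1) ^ G.dist r v

lemma paritySign_mul_paritySign (hconn : G.Connected) (hbip : G.IsBipartite) (r u v : V) :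
    paritySign G r u * paritySign G r v = (-1) ^ G.dist u v := by
  have C : G.Coloring Bool := hbip.toColoring (by simp)
  have hparity (a b : V) : Even (G.dist a b) ↔ (C a ↔ C b) := by
    obtain ⟨p, hp⟩ := hconn.exists_walk_length_eq_dist a b
    rw [← hp, C.even_length_iff_congr]
  have heven : Even (G.dist r u + G.dist r v) ↔ Even (G.dist u v) := by
    rw [Nat.even_add, hparity, hparity, hparity]
    tauto
  rw [paritySign, paritySign, ← pow_add]
  by_cases h : Even (G.dist u v)
  · rw [h.neg_one_pow, (heven.2 h).neg_one_pow]
  · rw [(Nat.not_even_iff_odd.1 h).neg_one_pow,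
      (Nat.not_even_iff_odd.1 (mt heven.1 h)).neg_one_pow]

lemma paritySign_mul_self (r v : V) : paritySign G r v * paritySign G r v = 1 := by
  rw [paritySign, ← mul_pow]
  norm_num

lemma paritySign_of_adj (hconn : G.Connected) (hbip : G.IsBipartite) (r : V) {u v : V}
    (huv : G.Adj u v) : paritySign G r v = -paritySign G r u := by
  have hprod := paritySign_mul_paritySign hconn hbip r u v
  rw [dist_eq_one_iff_adj.2 huv] at hprod
  linear_combination paritySign G r u * hprod - paritySign G r v * paritySign_mul_self (G := G) r u

variable [Fintype V] [DecidableRel G.Adj] {k : ℕ}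

lemma adjMatrix_mulVec_paritySign (hreg : G.IsRegularOfDegree k) (hconn : G.Connected)
    (hbip : G.IsBipartite) (r : V) :
    G.adjMatrix ℝ *ᵥ paritySign G r = (-(k : ℝ)) • paritySign G r := by
  ext v
  rw [adjMatrix_mulVec_apply, Finset.sum_congr rfl fun x hx =>
    paritySign_of_adj hconn hbip r ((mem_neighborFinset _ _ _).1 hx)]
  simp [hreg v]

/-- Eigenvectors of the symmetric matrix `A` for the eigenvalues `k` and `-k` are orthogonal. -/
lemma one_dotProduct_paritySign (hreg : G.IsRegularOfDegree k) (hk : 0 < k) (hconn : G.Connected)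
    (hbip : G.IsBipartite) (r : V) : 1 ⬝ᵥ paritySign G r = 0 := by
  have hsymm : 1 ⬝ᵥ (G.adjMatrix ℝ *ᵥ paritySign G r) = (k : ℝ) * (1 ⬝ᵥ paritySign G r) := by
    rw [dotProduct_mulVec, ← mulVec_transpose, transpose_adjMatrix, adjMatrix_mulVec_one hreg,
      smul_dotProduct, smul_eq_mul]
  rw [adjMatrix_mulVec_paritySign hreg hconn hbip, dotProduct_smul, smul_eq_mul] at hsymm
  have : (k : ℝ) ≠ 0 := by positivity
  have : (k : ℝ) * (1 ⬝ᵥ paritySign G r) = 0 := by linarith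
  simp_all

lemma exists_spectrumOf_adjMatrix_eq [DecidableEq V] (hreg : G.IsRegularOfDegree k) (hk : 0 < k)
    (hconn : G.Connected) (hbip : G.IsBipartite) :
    ∃ N : Multiset ℝ, spectrumOf (G.adjMatrix ℝ) = {(k : ℝ), -(k : ℝ)} + N := by
  obtain ⟨r⟩ := hconn.nonempty
  have hmem : (k : ℝ) ∈ spectrumOf (G.adjMatrix ℝ) :=
    mem_roots_charpoly_of_mulVec_eq_smul (fun h => by simpa using congrFun h r)
      (adjMatrix_mulVec_one hreg)
  have hmem_neg : -(k : ℝ) ∈ spectrumOf (G.adjMatrix ℝ) :=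
    mem_roots_charpoly_of_mulVec_eq_smul (fun h => by simpa [paritySign] using congrFun h r)
      (adjMatrix_mulVec_paritySign hreg hconn hbip r)
  have hne : (k : ℝ) ≠ -(k : ℝ) := by
    have : (0 : ℝ) < k := by positivity
    linarith
  have hle : ({(k : ℝ), -(k : ℝ)} : Multiset ℝ) ≤ spectrumOf (G.adjMatrix ℝ) := by
    refine (Multiset.le_iff_subset (by simpa using hne)).2 fun x hx => ?_
    simp only [Multiset.insert_eq_cons, Multiset.mem_cons, Multiset.mem_singleton] at hx
    rcases hx with rfl | rfl <;> assumption
  exact Multiset.le_iff_exists_add.1 hle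

end ParitySign

lemma excessMatrix_eq_adjMatrix {V : Type*} (G : SimpleGraph V) (d : ℕ) :
    excessMatrix G d = (excessGraph G d).adjMatrix ℝ := by
  ext u v
  rw [adjMatrix_apply]
  rfl

namespace HasSmallExcess

variable {V : Type*} [Fintype V] {G : SimpleGraph V} [DecidableRel G.Adj] {k d e : ℕ}
  (h : HasSmallExcess G k d e)

include h

lemma card_div_two : (Fintype.card V : ℝ) / 2 = (H k (d - 1)).eval (k : ℝ) + e / 2 := by
  rw [h.eval_H_valency_eq, h.card_eq]
  push_cast
  ring

/-- The last two summands have entry `1` at `(u, v)` if `dist u v` has the parity of `d - 1`, that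
is, if `dist u v` is `d + 1` or at most `d - 1`, and `0` otherwise. -/
lemma excessMatrix_eq [DecidableEq V] (r : V) :
    excessMatrix G d = Polynomial.aeval (G.adjMatrix ℝ) (-H k (d - 1)) +
      vecMulVec 1 ((1 / 2 : ℝ) • 1) +
      vecMulVec (paritySign G r) (((-1) ^ (d - 1) / 2 : ℝ) • paritySign G r) := by
  classical
  have hd := h.three_le
  ext u v
  have hle := h.dist_le_add_one u v
  rw [map_neg, Matrix.add_apply, Matrix.add_apply, Matrix.neg_apply, vecMulVec_apply,
    vecMulVec_apply, aeval_H_apply h.regular h.valency_pos h.le_egirth (by omega)]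
  have hsign : paritySign G r u * (((-1) ^ (d - 1) / 2 : ℝ) • paritySign G r) v =
      (-1) ^ (G.dist u v + (d - 1)) / 2 := by
    rw [Pi.smul_apply, smul_eq_mul, pow_add,
      ← paritySign_mul_paritySign h.connected h.isBipartite r]
    ring
  rw [hsign]
  simp only [h.hasWalk_iff (show d - 1 < d by omega), excessMatrix, of_apply, Pi.smul_apply,
    Pi.one_apply, smul_eq_mul]
  rcases Nat.even_or_odd (G.dist u v + (d - 1)) with hparity | hparity
  · have hiff : G.dist u v ≤ d - 1 ↔ G.dist u v ≠ d + 1 := by grind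
    simp only [hparity.neg_one_pow, hiff, Nat.even_add.1 hparity, and_true]
    by_cases hfar : G.dist u v = d + 1 <;> norm_num [hfar]
  · have hne : G.dist u v ≠ d + 1 := by grind
    rw [hparity.neg_one_pow, if_neg hne, if_neg fun hand => Nat.not_even_iff_odd.2 hparity
      (Nat.even_add.2 hand.2)]
    norm_num

lemma degree_excessGraph (u : V) : 2 * (excessGraph G d).degree u = e := by
  classical
  have hsum : (excessGraph G d).degree u = (e / 2 : ℝ) := by
    have horth := one_dotProduct_paritySign h.regular h.valency_pos h.connected h.isBipartite u
    rw [dotProduct_comm] at horth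
    calc ((excessGraph G d).degree u : ℝ) = (excessMatrix G d *ᵥ 1) u := by
          rw [excessMatrix_eq_adjMatrix, adjMatrix_mulVec_apply]
          simp
      _ = -(H k (d - 1)).eval (k : ℝ) + Fintype.card V / 2 := by
          rw [h.excessMatrix_eq u, add_mulVec, add_mulVec, vecMulVec_mulVec, vecMulVec_mulVec,
            smul_dotProduct, smul_dotProduct, horth,
            aeval_mulVec_of_mulVec_eq_smul (adjMatrix_mulVec_one h.regular)]
          simp [dotProduct, div_eq_inv_mul]
      _ = e / 2 := by
          rw [h.card_div_two]
          ring
  rify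
  linarith

/-- By `excessMatrix_eq`, `E` differs from `-H_{d-1}(A)` by rank-one perturbations along the
eigenvectors of `A` for `k` and `-k`, which move only the corresponding two eigenvalues. -/
lemma spectrumOf_excessMatrix [DecidableEq V] {N : Multiset ℝ}
    (hN : spectrumOf (G.adjMatrix ℝ) = {(k : ℝ), -(k : ℝ)} + N) :
    spectrumOf (excessMatrix G d) =
      {(e / 2 : ℝ), (e / 2 : ℝ) * (-1) ^ (d - 1)} + N.map fun x => -(H k (d - 1)).eval x := by
  obtain ⟨r⟩ := h.connected.nonempty
  have hone := adjMatrix_mulVec_one h.regular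
  have hsign := adjMatrix_mulVec_paritySign h.regular h.connected h.isBipartite r
  have horth := one_dotProduct_paritySign h.regular h.valency_pos h.connected h.isBipartite r
  have hroots := roots_charpoly_aeval (A := G.adjMatrix ℝ) (G.isHermitian_adjMatrix ℝ)
    (-H k (d - 1))
  rw [spectrumOf] at hN
  rw [hN] at hroots
  have hperturbed := roots_charpoly_add_vecMulVec_add_vecMulVec
    (((-1) ^ (d - 1) / 2 : ℝ) • paritySign G r)
    (aeval_mulVec_of_mulVec_eq_smul hone (-H k (d - 1)))
    (aeval_mulVec_of_mulVec_eq_smul hsign (-H k (d - 1)))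
    (w₁ := (1 / 2 : ℝ) • 1) (by rw [smul_dotProduct, horth, smul_zero]) (by simpa using hroots)
  rw [← h.excessMatrix_eq r] at hperturbed
  have hpos : (-H k (d - 1)).eval (k : ℝ) + 1 ⬝ᵥ ((1 / 2 : ℝ) • (1 : V → ℝ)) = e / 2 := by
    simp only [dotProduct_smul, one_dotProduct_one, smul_eq_mul, Polynomial.eval_neg]
    linear_combination h.card_div_two
  have hneg : (-H k (d - 1)).eval (-(k : ℝ)) +
      paritySign G r ⬝ᵥ (((-1) ^ (d - 1) / 2 : ℝ) • paritySign G r) = e / 2 * (-1) ^ (d - 1) := by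
    have hnorm : paritySign G r ⬝ᵥ paritySign G r = Fintype.card V := by
      simp [dotProduct, paritySign_mul_self]
    rw [dotProduct_smul, hnorm, smul_eq_mul, Polynomial.eval_neg, eval_H_neg]
    linear_combination (-1) ^ (d - 1) * h.card_div_two
  rw [spectrumOf, hperturbed, hpos, hneg]
  simp

end HasSmallExcess

section TwoRegular

variable {V W : Type*} {G : SimpleGraph V}

lemma adj_getVert_of_cycleGraph_adj {v : V} {p : G.Walk v v} {x y : Fin p.length}
    (hxy : (cycleGraph p.length).Adj x y) : G.Adj (p.getVert x) (p.getVert y) := by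
  have hsucc {x y : Fin p.length} (h : (y - x).val = 1) : G.Adj (p.getVert x) (p.getVert y) := by
    have hadj := p.adj_getVert_succ x.2
    rw [Fin.val_sub] at h
    rcases Nat.lt_or_ge (p.length - x + y) p.length with hlt | hle
    · rw [Nat.mod_eq_of_lt hlt] at h
      rw [show (x : ℕ) + 1 = p.length by omega, p.getVert_length] at hadj
      rwa [show (y : ℕ) = 0 by omega, p.getVert_zero]
    · rw [Nat.mod_eq_sub_mod hle, Nat.mod_eq_of_lt (by omega)] at h
      rwa [show (x : ℕ) + 1 = y by omega] at hadj
  rcases cycleGraph_adj'.1 hxy with h | h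
  · exact (hsucc h).symm
  · exact hsucc h

lemma range_getVert {v : V} {p : G.Walk v v} (hp : 0 < p.length) :
    Set.range (fun x : Fin p.length => p.getVert x) = {u | u ∈ p.support} := by
  ext u
  simp only [Set.mem_range, Set.mem_ofPred_eq, Walk.mem_support_iff_exists_getVert]
  constructor
  · rintro ⟨x, rfl⟩
    exact ⟨x, rfl, x.2.le⟩
  · rintro ⟨m, rfl, hm⟩
    rcases hm.eq_or_lt with rfl | hlt
    · exact ⟨⟨0, hp⟩, by simp⟩
    · exact ⟨⟨m, hlt⟩, rfl⟩

lemma exists_injective_hom_cycleGraph [Finite V] (hG : ∀ v, (G.neighborSet v).ncard = 2)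
    (C : G.ConnectedComponent) : ∃ n, 3 ≤ n ∧
      ∃ f : cycleGraph n →g G, Function.Injective f ∧ Set.range f = C.supp := by
  have hcycles : G.IsCycles := fun v _ => hG v
  obtain ⟨v, hv⟩ := C.nonempty_supp
  obtain ⟨p, hp, hsupp⟩ := hcycles.exists_cycle_toSubgraph_verts_eq_connectedComponentSupp hv
    (Set.nonempty_of_ncard_ne_zero (by rw [hG v]; decide))
  have hlen := hp.three_le_length
  refine ⟨p.length, hlen, ⟨fun x => p.getVert x, adj_getVert_of_cycleGraph_adj⟩,
    fun x y hxy => ?_, ?_⟩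
  · exact Fin.ext (hp.getVert_injOn' (Nat.le_pred_of_lt x.2) (Nat.le_pred_of_lt y.2) hxy)
  · rw [← hsupp, Walk.verts_toSubgraph, ← range_getVert (by omega)]
    rfl

lemma ncard_neighborSet_cycleGraph {n : ℕ} (hn : 3 ≤ n) (x : Fin n) :
    ((cycleGraph n).neighborSet x).ncard = 2 := by
  obtain ⟨m, rfl⟩ := Nat.exists_eq_add_of_le' hn
  rw [← cycleGraph_degree_three_le (v := x), ← card_neighborSet_eq_degree,
    Set.ncard_eq_toFinset_card', Set.toFinset_card]

lemma cycleUnion_adj {c : ℕ} {l : Fin c → ℕ} {i j : Fin c} {x : Fin (l i)} {y : Fin (l j)} :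
    (cycleUnion l).Adj ⟨i, x⟩ ⟨j, y⟩ ↔ ∃ h : i = j, (cycleGraph (l j)).Adj (h ▸ x) y := by
  constructor
  · rintro ⟨i', x', y', ⟨⟩, ⟨⟩, h⟩
    exact ⟨rfl, h⟩
  · rintro ⟨rfl, h⟩
    exact ⟨i, x, y, rfl, rfl, h⟩

lemma ncard_neighborSet_cycleUnion {c : ℕ} {l : Fin c → ℕ} (hl : ∀ i, 3 ≤ l i)
    (a : Σ i : Fin c, Fin (l i)) : ((cycleUnion l).neighborSet a).ncard = 2 := by
  obtain ⟨i, x⟩ := a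
  have himage : (cycleUnion l).neighborSet ⟨i, x⟩ =
      Sigma.mk i '' (cycleGraph (l i)).neighborSet x := by
    ext ⟨j, y⟩
    rw [mem_neighborSet, cycleUnion_adj]
    constructor
    · rintro ⟨rfl, h⟩
      exact ⟨y, h, rfl⟩
    · rintro ⟨z, hz, ⟨⟩⟩
      exact ⟨rfl, hz⟩
  rw [himage, Set.ncard_image_of_injective _ sigma_mk_injective,
    ncard_neighborSet_cycleGraph (hl i)]

lemma adj_iff_of_ncard_neighborSet_le [Finite W] {G' : SimpleGraph W} {f : G →g G'}
    (hf : Function.Injective f)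
    (hcard : ∀ v, (G'.neighborSet (f v)).ncard ≤ (G.neighborSet v).ncard) {u v : V} :
    G'.Adj (f u) (f v) ↔ G.Adj u v := by
  have himage : f '' G.neighborSet u = G'.neighborSet (f u) :=
    Set.eq_of_subset_of_ncard_le (Set.image_subset_iff.2 fun _ => f.map_adj)
      ((hcard u).trans_eq (Set.ncard_image_of_injective _ hf).symm) (Set.toFinite _)
  rw [← mem_neighborSet, ← himage, hf.mem_set_image, mem_neighborSet]

theorem exists_iso_cycleUnion [Finite V] (hG : ∀ v, (G.neighborSet v).ncard = 2) :
    ∃ (c : ℕ) (l : Fin c → ℕ) (_ : cycleUnion l ≃g G), ∀ i, 3 ≤ l i := by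
  choose n hn f hf hrange using exists_injective_hom_cycleGraph hG
  obtain ⟨c, ⟨e⟩⟩ := Finite.exists_equiv_fin G.ConnectedComponent
  let l (i : Fin c) : ℕ := n (e.symm i)
  have hl (i : Fin c) : 3 ≤ l i := hn _
  let φ : cycleUnion l →g G := ⟨fun a => f (e.symm a.1) a.2, by
    rintro ⟨i, x⟩ ⟨j, y⟩ h
    obtain ⟨rfl, h⟩ := cycleUnion_adj.1 h
    exact (f _).map_adj h⟩
  have hcomponent (a : Σ i, Fin (l i)) : G.connectedComponentMk (φ a) = e.symm a.1 := by
    rw [← ConnectedComponent.mem_supp_iff, ← hrange]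
    exact Set.mem_range_self a.2
  have hinjective : Function.Injective φ := by
    rintro ⟨i, x⟩ ⟨j, y⟩ hxy
    obtain rfl : i = j := e.symm.injective (by rw [← hcomponent ⟨i, x⟩, hxy, hcomponent])
    obtain rfl : x = y := hf _ hxy
    rfl
  have hsurjective : Function.Surjective φ := by
    intro v
    obtain ⟨i, hi⟩ := e.symm.surjective (G.connectedComponentMk v)
    have hv : v ∈ (e.symm i).supp := hi.symm
    rw [← hrange] at hv
    obtain ⟨x, rfl⟩ := hv
    exact ⟨⟨i, x⟩, rfl⟩
  refine ⟨c, l, ⟨Equiv.ofBijective φ ⟨hinjective, hsurjective⟩, ?_⟩, hl⟩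
  exact adj_iff_of_ncard_neighborSet_le hinjective fun a => by
    rw [hG, ncard_neighborSet_cycleUnion hl]

end TwoRegular

/-- The eigenvalue of the disjoint union of the cycles of lengths `l i` that corresponds to the
pair `p = (i, j)`. -/
noncomputable def cycleEigenvalue {c : ℕ} (l : Fin c → ℕ) (p : Σ _ : Fin c, ℕ) : ℝ :=
  2 * Real.cos (2 * Real.pi * p.2 / l p.1)

section CycleSpectrum

open Polynomial

lemma spectrumOf_adjMatrix_eq_of_iso {V W : Type*} [Fintype V] [DecidableEq V] [Fintype W]
    [DecidableEq W] {G : SimpleGraph V} {G' : SimpleGraph W} [DecidableRel G.Adj]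
    [DecidableRel G'.Adj] (e : G ≃g G') :
    spectrumOf (G'.adjMatrix ℝ) = spectrumOf (G.adjMatrix ℝ) := by
  rw [spectrumOf, ← Iso.reindex_adjMatrix ℝ e, charpoly_reindex, spectrumOf]

lemma exp_pow_add_inv_eq_two_mul_cos (n j : ℕ) :
    Complex.exp (2 * Real.pi * Complex.I / n) ^ j +
      (Complex.exp (2 * Real.pi * Complex.I / n) ^ j)⁻¹ =
      ((2 * Real.cos (2 * Real.pi * j / n) : ℝ) : ℂ) := by
  have hangle : (j : ℂ) * (2 * Real.pi * Complex.I / n) = 2 * Real.pi * j / n * Complex.I := by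
    ring
  rw [← Complex.exp_nat_mul, ← Complex.exp_neg, hangle, ← neg_mul]
  push_cast
  rw [Complex.two_cos]

lemma adjMatrix_cycleGraph_mul_vandermonde {K : Type*} [Field K] {m : ℕ} {ζ : K}
    (hζ : ζ ^ (m + 3) = 1) :
    (cycleGraph (m + 3)).adjMatrix K * vandermonde (fun x : Fin (m + 3) => ζ ^ (x : ℕ)) =
      vandermonde (fun x : Fin (m + 3) => ζ ^ (x : ℕ)) *
        diagonal (fun j : Fin (m + 3) => ζ ^ (j : ℕ) + (ζ ^ (j : ℕ))⁻¹) := by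
  have hζ0 : ζ ≠ 0 := (IsUnit.of_pow_eq_one hζ (by omega)).ne_zero
  have hsucc (y : Fin (m + 3)) : ζ ^ ((y + 1 : Fin (m + 3)) : ℕ) = ζ ^ (y : ℕ) * ζ := by
    rw [← pow_succ, Fin.val_add, Fin.val_one, ← pow_eq_pow_mod _ hζ]
  have hpred (y : Fin (m + 3)) : ζ ^ ((y - 1 : Fin (m + 3)) : ℕ) = ζ ^ (y : ℕ) * ζ⁻¹ := by
    rw [eq_mul_inv_iff_mul_eq₀ hζ0, ← hsucc, sub_add_cancel]
  ext x j
  have hne : x - 1 ≠ x + 1 := by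
    simp only [ne_eq, sub_eq_iff_eq_add, add_assoc x, left_eq_add]
    exact ne_of_beq_false rfl
  rw [adjMatrix_mul_apply, cycleGraph_neighborFinset, Finset.sum_pair hne, mul_diagonal]
  simp only [vandermonde_apply, hsucc, hpred, mul_pow, inv_pow]
  ring

lemma charpoly_adjMatrix_cycleGraph_eq_prod_of_isPrimitiveRoot {K : Type*} [Field K] {n : ℕ}
    (hn : 3 ≤ n) {ζ : K} (hζ : IsPrimitiveRoot ζ n) :
    ((cycleGraph n).adjMatrix K).charpoly =
      ∏ j ∈ Finset.range n, (X - C (ζ ^ j + (ζ ^ j)⁻¹)) := by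
  obtain ⟨m, rfl⟩ := Nat.exists_eq_add_of_le' hn
  obtain ⟨U, hU⟩ : IsUnit (vandermonde fun x : Fin (m + 3) => ζ ^ (x : ℕ)) := by
    rw [isUnit_iff_isUnit_det, isUnit_iff_ne_zero, det_vandermonde_ne_zero_iff]
    exact fun x y hxy => Fin.ext (hζ.pow_inj x.2 y.2 hxy)
  have hdiag := adjMatrix_cycleGraph_mul_vandermonde hζ.pow_eq_one
  rw [← hU, ← Units.eq_mul_inv_iff_mul_eq] at hdiag
  rw [hdiag, coe_units_inv, charpoly_units_conj, charpoly_diagonal, Finset.prod_range]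

lemma charpoly_adjMatrix_cycleGraph {n : ℕ} (hn : 3 ≤ n) :
    ((cycleGraph n).adjMatrix ℝ).charpoly =
      ∏ j ∈ Finset.range n, (X - C (2 * Real.cos (2 * Real.pi * j / n))) := by
  have hmap : ((cycleGraph n).adjMatrix ℝ).map Complex.ofRealHom = (cycleGraph n).adjMatrix ℂ := by
    ext x y
    rw [map_apply, adjMatrix_apply, adjMatrix_apply]
    split_ifs <;> simp
  apply Polynomial.map_injective Complex.ofRealHom Complex.ofReal_injective
  rw [← charpoly_map, hmap, charpoly_adjMatrix_cycleGraph_eq_prod_of_isPrimitiveRoot hn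
    (Complex.isPrimitiveRoot_exp n (by omega)), Polynomial.map_prod]
  refine Finset.prod_congr rfl fun j _ => ?_
  rw [exp_pow_add_inv_eq_two_mul_cos]
  simp

lemma det_blockDiagonal' {o R : Type*} [Fintype o] [LinearOrder o] [CommRing R]
    {n : o → Type*} [∀ i, Fintype (n i)] [∀ i, DecidableEq (n i)]
    (M : ∀ i, Matrix (n i) (n i) R) : (blockDiagonal' M).det = ∏ i, (M i).det := by
  rw [(blockTriangular_blockDiagonal' M).det_fintype]
  refine Finset.prod_congr rfl fun i _ => ?_
  rw [← det_submatrix_equiv_self (Equiv.sigmaSubtype i).symm]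
  congr 1
  ext x y
  exact blockDiagonal'_apply_eq M i x y

lemma charpoly_blockDiagonal' {o R : Type*} [Fintype o] [LinearOrder o] [CommRing R]
    {n : o → Type*} [∀ i, Fintype (n i)] [∀ i, DecidableEq (n i)]
    (M : ∀ i, Matrix (n i) (n i) R) : (blockDiagonal' M).charpoly = ∏ i, (M i).charpoly := by
  have hcharmatrix : (blockDiagonal' M).charmatrix = blockDiagonal' fun i => (M i).charmatrix := by
    ext1 ⟨i, x⟩ ⟨j, y⟩
    by_cases hij : i = j
    · subst hij
      simp [charmatrix_apply, diagonal_apply]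
    · rw [blockDiagonal'_apply_ne _ _ _ hij, charmatrix_apply_ne _ _ _
        fun h => hij (congrArg Sigma.fst h), blockDiagonal'_apply_ne _ _ _ hij, map_zero, neg_zero]
  rw [charpoly, hcharmatrix, det_blockDiagonal']
  rfl

open scoped Classical in
lemma adjMatrix_cycleUnion {c : ℕ} (l : Fin c → ℕ) :
    (cycleUnion l).adjMatrix ℝ = blockDiagonal' fun i => (cycleGraph (l i)).adjMatrix ℝ := by
  ext ⟨i, x⟩ ⟨j, y⟩
  rw [adjMatrix_apply]
  by_cases hij : i = j
  · subst hij
    simp [cycleUnion_adj, adjMatrix_apply]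
  · rw [blockDiagonal'_apply_ne _ _ _ hij, if_neg]
    exact fun h => hij (cycleUnion_adj.1 h).1

open scoped Classical in
lemma spectrumOf_adjMatrix_cycleUnion {c : ℕ} {l : Fin c → ℕ} (hl : ∀ i, 3 ≤ l i) :
    spectrumOf ((cycleUnion l).adjMatrix ℝ) = Multiset.replicate c 2 +
      (cycleIndices l).val.map (cycleEigenvalue l) := by
  have hzero (i : Fin c) : Finset.range (l i) = insert 0 (Finset.Icc 1 (l i - 1)) := by
    have := hl i
    grind
  have hcharpoly : ((cycleUnion l).adjMatrix ℝ).charpoly = (X - C 2) ^ c *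
      ∏ p ∈ cycleIndices l, (X - C (cycleEigenvalue l p)) := by
    simp only [adjMatrix_cycleUnion, charpoly_blockDiagonal', charpoly_adjMatrix_cycleGraph (hl _),
      hzero]
    simp [cycleEigenvalue, cycleIndices, Finset.prod_sigma, Finset.prod_mul_distrib]
  have hprod : ∏ p ∈ cycleIndices l, (X - C (cycleEigenvalue l p)) ≠ 0 :=
    Finset.prod_ne_zero_iff.2 fun p _ => X_sub_C_ne_zero _
  rw [spectrumOf, hcharpoly, roots_mul (mul_ne_zero (pow_ne_zero _ (X_sub_C_ne_zero _)) hprod),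
    roots_pow, roots_X_sub_C, Multiset.nsmul_singleton, roots_prod _ _ hprod]
  simp only [roots_X_sub_C, Multiset.bind_singleton]

end CycleSpectrum

section Multiset

variable {α β ι : Type*} {f : α → β} {θ : ι → β} {b : β}

lemma exists_eq_replicate_add_of_cons_eq {s t : Multiset β} {c : ℕ} (hb : b ∉ t)
    (h : b ::ₘ s = Multiset.replicate c b + t) :
    ∃ m, m + 1 = c ∧ s = Multiset.replicate m b + t := by
  cases c with
  | zero =>
    rw [Multiset.replicate_zero, zero_add] at h
    exact absurd (h ▸ Multiset.mem_cons_self b s) hb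
  | succ m =>
    rw [Multiset.replicate_succ, Multiset.cons_add, Multiset.cons_inj_right] at h
    exact ⟨m, rfl, h⟩

lemma exists_eq_add_of_map_eq_add {N : Multiset α} {s t : Multiset β} (h : N.map f = s + t) :
    ∃ S T, N = S + T ∧ S.map f = s ∧ T.map f = t := by
  classical
  induction s using Multiset.induction generalizing N with
  | empty => exact ⟨0, N, by simpa using h⟩
  | cons b s ih =>
    rw [Multiset.cons_add] at h
    obtain ⟨x, hx, rfl, herase⟩ := (Multiset.map_eq_cons f _ _ _).2 h
    obtain ⟨S, T, hN, rfl, rfl⟩ := ih herase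
    exact ⟨x ::ₘ S, T, by rw [Multiset.cons_add, ← hN, Multiset.cons_erase hx], by simp⟩

lemma exists_eq_map_of_map_eq [Nonempty α] {s : Finset ι} {N : Multiset α}
    (h : N.map f = s.val.map θ) :
    ∃ μ : ι → α, N = s.val.map μ ∧ ∀ p ∈ s, f (μ p) = θ p := by
  classical
  induction s using Finset.induction_on generalizing N with
  | empty => exact ⟨fun _ => Classical.arbitrary α, by simpa using h⟩
  | insert a s ha ih =>
    rw [Finset.insert_val_of_notMem ha, Multiset.map_cons] at h
    obtain ⟨x, hx, hfx, herase⟩ := (Multiset.map_eq_cons f _ _ _).2 h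
    obtain ⟨μ, hμ, hf⟩ := ih herase
    have hupdate : ∀ p ∈ s, Function.update μ a x p = μ p := fun p hp =>
      Function.update_of_ne (ne_of_mem_of_not_mem hp ha) x μ
    refine ⟨Function.update μ a x, ?_, ?_⟩
    · rw [Finset.insert_val_of_notMem ha, Multiset.map_cons, Function.update_self,
        Multiset.map_congr rfl hupdate, ← hμ, Multiset.cons_erase hx]
    · rw [Finset.forall_mem_insert, Function.update_self]
      exact ⟨hfx, fun p hp => by rw [hupdate p hp, hf p hp]⟩

lemma exists_eq_add_map_of_map_eq [Nonempty α] {N : Multiset α} {m : ℕ} {s : Finset ι}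
    (h : N.map f = Multiset.replicate m b + s.val.map θ) :
    ∃ (S : Multiset α) (μ : ι → α), S.card = m ∧ (∀ x ∈ S, f x = b) ∧
      (∀ p ∈ s, f (μ p) = θ p) ∧ N = S + s.val.map μ := by
  obtain ⟨S, T, rfl, hS, hT⟩ := exists_eq_add_of_map_eq_add h
  obtain ⟨μ, rfl, hμ⟩ := exists_eq_map_of_map_eq hT
  rw [Multiset.eq_replicate, Multiset.card_map, Multiset.forall_mem_map_iff] at hS
  exact ⟨S, μ, hS.1, hS.2, hμ, rfl⟩

end Multiset

section CycleEigenvalue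

variable {c : ℕ} {l : Fin c → ℕ} {p : Σ _ : Fin c, ℕ}

lemma mem_cycleIndices : p ∈ cycleIndices l ↔ 1 ≤ p.2 ∧ p.2 ≤ l p.1 - 1 := by
  simp [cycleIndices]

lemma angle_mem_Ioo (hp : p ∈ cycleIndices l) :
    2 * Real.pi * (p.2 : ℝ) / (l p.1 : ℝ) ∈ Set.Ioo 0 (2 * Real.pi) := by
  obtain ⟨hpos, hlt⟩ := mem_cycleIndices.1 hp
  have hpos' : (0 : ℝ) < p.2 := by exact_mod_cast hpos
  have hlt' : (p.2 : ℝ) < l p.1 := by exact_mod_cast (by omega)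
  have hl : (0 : ℝ) < l p.1 := hpos'.trans hlt'
  refine ⟨by positivity, ?_⟩
  rw [div_lt_iff₀ hl]
  gcongr

lemma cycleEigenvalue_ne_two (hp : p ∈ cycleIndices l) : cycleEigenvalue l p ≠ 2 := by
  obtain ⟨hpos, hlt⟩ := angle_mem_Ioo hp
  intro h
  rw [cycleEigenvalue, mul_eq_left₀ two_ne_zero,
    Real.cos_eq_one_iff_of_lt_of_lt (by linarith [Real.pi_pos]) hlt] at h
  exact hpos.ne' h

lemma two_notMem_map_cycleEigenvalue {s : Finset (Σ _ : Fin c, ℕ)} (hs : s ⊆ cycleIndices l) :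
    2 ∉ s.val.map (cycleEigenvalue l) := fun h => by
  obtain ⟨p, hp, hp2⟩ := Multiset.mem_map.1 h
  exact cycleEigenvalue_ne_two (hs hp) hp2

lemma two_mul_eq_of_cycleEigenvalue_eq_neg_two (hp : p ∈ cycleIndices l)
    (h : cycleEigenvalue l p = -2) : 2 * p.2 = l p.1 := by
  obtain ⟨hpos, hlt⟩ := angle_mem_Ioo hp
  have hl : (l p.1 : ℝ) ≠ 0 := fun h0 => by simp [h0] at hpos
  have hcos : Real.cos (2 * Real.pi * p.2 / l p.1 - Real.pi) = 1 := by
    rw [cycleEigenvalue] at h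
    rw [Real.cos_sub_pi]
    linarith
  rw [Real.cos_eq_one_iff_of_lt_of_lt (by linarith [Real.pi_pos]) (by linarith), sub_eq_zero,
    div_eq_iff hl] at hcos
  have : (2 * p.2 : ℝ) = l p.1 := mul_left_cancel₀ Real.pi_ne_zero (by linarith)
  exact_mod_cast this

end CycleEigenvalue

section Reachable

variable {V : Type*} {G : SimpleGraph V} {u v : V}

lemma iff_of_reachable {P : V → Prop} (hP : ∀ u v, G.Adj u v → (P u ↔ P v))
    (huv : G.Reachable u v) : P u ↔ P v := by
  obtain ⟨p⟩ := huv
  induction p with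
  | nil => rfl
  | cons hadj _ ih => exact (hP _ _ hadj).trans ih

lemma reachable_cycleUnion {c : ℕ} {l : Fin c → ℕ} (i : Fin c) (x y : Fin (l i)) :
    (cycleUnion l).Reachable ⟨i, x⟩ ⟨i, y⟩ :=
  (cycleGraph_preconnected x y).map ⟨Sigma.mk i, fun h => cycleUnion_adj.2 ⟨rfl, h⟩⟩

lemma mem_iff_mem_of_even_dist {V₁ V₂ : Set V} (hb : G.IsBipartiteWith V₁ V₂)
    (hreach : G.Reachable u v) (heven : Even (G.dist u v)) : u ∈ V₁ ↔ v ∈ V₁ := by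
  classical
  have hdisjoint {w : V} (hw : w ∈ V₂) : w ∉ V₁ := Set.disjoint_right.1 hb.disjoint hw
  let C : G.Coloring Bool := Coloring.mk (fun w => decide (w ∈ V₁)) fun hadj => by
    rcases hb.mem_of_adj hadj with ⟨hv, hw⟩ | ⟨hv, hw⟩ <;> simp [hv, hw, hdisjoint]
  obtain ⟨p, hp⟩ := hreach.exists_walk_length_eq_dist
  have hC (w : V) : C w = true ↔ w ∈ V₁ := decide_eq_true_iff
  rwa [← hp, C.even_length_iff_congr, hC, hC] at heven

end Reachable

namespace HasSmallExcess

variable {V : Type*} [Fintype V] {G : SimpleGraph V} [DecidableRel G.Adj] {k d e : ℕ}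
  (h : HasSmallExcess G k d e)

include h

lemma two_lt_eval_H_valency : 2 < (H k (d - 1)).eval (k : ℝ) := by
  have hk := h.add_two_le
  have hsum : d ≤ ∑ i ∈ Finset.range d, (k - 1) ^ i := by
    simpa using Finset.card_nsmul_le_sum (Finset.range d) (fun i => (k - 1) ^ i) 1
      fun i _ => Nat.one_le_pow _ _ (by omega)
  rw [h.eval_H_valency_eq]
  exact_mod_cast h.three_le.trans hsum

lemma card_filter_eval_H_eq [DecidableEq V] {N t : Multiset ℝ} {m : ℕ}
    (hspec : spectrumOf (G.adjMatrix ℝ) = {(k : ℝ), -(k : ℝ)} + N)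
    (hN : (N.map fun x => -(H k (d - 1)).eval x) = Multiset.replicate m 2 + t) (ht : 2 ∉ t) :
    ((spectrumOf (G.adjMatrix ℝ)).filter fun x => (H k (d - 1)).eval x = -2).card = m := by
  have hvalency := h.two_lt_eval_H_valency
  have hpos : (H k (d - 1)).eval (k : ℝ) ≠ -2 := by linarith
  have hneg : (H k (d - 1)).eval (-(k : ℝ)) ≠ -2 := by
    rw [eval_H_neg]
    rcases neg_one_pow_eq_or ℝ (d - 1) with hsign | hsign <;> rw [hsign] <;> intro <;> linarith
  have hcount := congrArg (Multiset.count 2) hN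
  rw [Multiset.count_map, Multiset.count_add, Multiset.count_replicate_self,
    Multiset.count_eq_zero.2 ht, add_zero] at hcount
  simp only [eq_comm (a := (2 : ℝ)), neg_eq_iff_eq_neg] at hcount
  rw [hspec, Multiset.insert_eq_cons, Multiset.cons_add, Multiset.singleton_add,
    Multiset.filter_cons_of_neg (p := fun x => (H k (d - 1)).eval x = -2) _ hpos,
    Multiset.filter_cons_of_neg (p := fun x => (H k (d - 1)).eval x = -2) _ hneg, hcount]

lemma cycle_subset_of_odd (hd : Odd d) {c : ℕ} {l : Fin c → ℕ}
    (φ : cycleUnion l ≃g excessGraph G d) {V₁ V₂ : Set V} (hb : G.IsBipartiteWith V₁ V₂)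
    (hunion : V₁ ∪ V₂ = Set.univ) (i : Fin c) :
    (∀ x : Fin (l i), φ ⟨i, x⟩ ∈ V₁) ∨ (∀ x : Fin (l i), φ ⟨i, x⟩ ∈ V₂) := by
  have hadj (u v : V) (huv : (excessGraph G d).Adj u v) : u ∈ V₁ ↔ v ∈ V₁ := by
    have hdist : G.dist u v = d + 1 := huv
    exact mem_iff_mem_of_even_dist hb (h.connected u v) (hdist ▸ hd.add_one)
  have hcycle (x y : Fin (l i)) : φ ⟨i, x⟩ ∈ V₁ ↔ φ ⟨i, y⟩ ∈ V₁ :=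
    iff_of_reachable hadj (φ.reachable_iff.2 (reachable_cycleUnion i x y))
  by_cases hx : ∃ x : Fin (l i), φ ⟨i, x⟩ ∈ V₁
  · obtain ⟨x, hx⟩ := hx
    exact Or.inl fun y => (hcycle x y).1 hx
  · refine Or.inr fun y => ?_
    have hy : φ ⟨i, y⟩ ∈ V₁ ∪ V₂ := hunion ▸ Set.mem_univ _
    exact hy.resolve_left fun hy => hx ⟨y, hy⟩

end HasSmallExcess

lemma exists_solutions_of_map_neg_eval_H_eq {k n m c : ℕ} {l : Fin c → ℕ}
    {s : Finset (Σ _ : Fin c, ℕ)} {N : Multiset ℝ}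
    (hN : (N.map fun x => -(H k n).eval x) =
      Multiset.replicate m 2 + s.val.map (cycleEigenvalue l)) :
    ∃ (S : Multiset ℝ) (μ : (Σ _ : Fin c, ℕ) → ℝ), S.card = m ∧
      (∀ x ∈ S, (H k n).eval x = -2) ∧
      (∀ p ∈ s, (H k n).eval (μ p) = -2 * Real.cos (2 * Real.pi * (p.2 : ℝ) / (l p.1 : ℝ))) ∧
      N = S + s.val.map μ := by
  obtain ⟨S, μ, hcard, hS, hμ, rfl⟩ := exists_eq_add_map_of_map_eq hN
  refine ⟨S, μ, hcard, fun x hx => neg_eq_iff_eq_neg.1 (hS x hx), fun p hp => ?_, rfl⟩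
  rw [neg_mul, ← neg_eq_iff_eq_neg]
  exact hμ p hp

namespace HasSmallExcess

section ExcessFour

variable {V : Type*} [Fintype V] {G : SimpleGraph V} [DecidableRel G.Adj] {k d : ℕ}
  (h : HasSmallExcess G k d 4)

include h

lemma ncard_neighborSet_excessGraph (u : V) : ((excessGraph G d).neighborSet u).ncard = 2 := by
  have hdegree := h.degree_excessGraph u
  rw [← Nat.card_coe_set_eq, Nat.card_eq_fintype_card, card_neighborSet_eq_degree]
  omega

variable [DecidableEq V] {c : ℕ} {l : Fin c → ℕ} (hl : ∀ i, 3 ≤ l i)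
  (φ : cycleUnion l ≃g excessGraph G d)

include hl φ

lemma exists_spectrumOf_eq : ∃ N : Multiset ℝ,
    spectrumOf (G.adjMatrix ℝ) = {(k : ℝ), -(k : ℝ)} + N ∧
    2 ::ₘ 2 * (-1) ^ (d - 1) ::ₘ (N.map fun x => -(H k (d - 1)).eval x) =
      Multiset.replicate c 2 + (cycleIndices l).val.map (cycleEigenvalue l) := by
  classical
  obtain ⟨N, hN⟩ := exists_spectrumOf_adjMatrix_eq h.regular h.valency_pos h.connected
    h.isBipartite
  have htwo : ((4 : ℕ) / 2 : ℝ) = 2 := by norm_num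
  refine ⟨N, hN, ?_⟩
  rw [← spectrumOf_adjMatrix_cycleUnion hl, ← spectrumOf_adjMatrix_eq_of_iso φ,
    ← excessMatrix_eq_adjMatrix, h.spectrumOf_excessMatrix hN, htwo, Multiset.insert_eq_cons,
    Multiset.cons_add, Multiset.singleton_add]

lemma exists_spectrumOf_eq_of_odd (hd : Odd d) : ∃ (N : Multiset ℝ) (m : ℕ), m + 2 = c ∧
    spectrumOf (G.adjMatrix ℝ) = {(k : ℝ), -(k : ℝ)} + N ∧
    (N.map fun x => -(H k (d - 1)).eval x) =
      Multiset.replicate m 2 + (cycleIndices l).val.map (cycleEigenvalue l) := by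
  obtain ⟨N, hN, hmap⟩ := h.exists_spectrumOf_eq hl φ
  have htwo := two_notMem_map_cycleEigenvalue (Finset.Subset.refl (cycleIndices l))
  rw [(Nat.Odd.sub_odd hd odd_one).neg_one_pow, mul_one] at hmap
  obtain ⟨m₁, hm₁, hmap⟩ := exists_eq_replicate_add_of_cons_eq htwo hmap
  obtain ⟨m, hm, hmap⟩ := exists_eq_replicate_add_of_cons_eq htwo hmap
  exact ⟨N, m, by omega, hN, hmap⟩

lemma exists_spectrumOf_eq_of_even (hd : Even d) :
    ∃ (N : Multiset ℝ) (m : ℕ) (p₀ : Σ _ : Fin c, ℕ), m + 1 = c ∧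
      p₀ ∈ cycleIndices l ∧ 2 * p₀.2 = l p₀.1 ∧
      spectrumOf (G.adjMatrix ℝ) = {(k : ℝ), -(k : ℝ)} + N ∧
      (N.map fun x => -(H k (d - 1)).eval x) =
        Multiset.replicate m 2 + ((cycleIndices l).erase p₀).val.map (cycleEigenvalue l) := by
  obtain ⟨N, hN, hmap⟩ := h.exists_spectrumOf_eq hl φ
  have htwo := two_notMem_map_cycleEigenvalue (Finset.Subset.refl (cycleIndices l))
  have hodd : Odd (d - 1) := Nat.Even.sub_odd (by linarith [h.three_le]) hd odd_one
  rw [hodd.neg_one_pow, mul_neg_one] at hmap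
  obtain ⟨m, hm, hmap⟩ := exists_eq_replicate_add_of_cons_eq htwo hmap
  have hmem : (-2 : ℝ) ∈ Multiset.replicate m 2 + (cycleIndices l).val.map (cycleEigenvalue l) :=
    hmap ▸ Multiset.mem_cons_self _ _
  obtain ⟨p₀, hp₀, hp₀_eq⟩ := Multiset.mem_map.1 <| (Multiset.mem_add.1 hmem).resolve_left
    fun hrep => by linarith [Multiset.eq_of_mem_replicate hrep]
  refine ⟨N, m, p₀, hm, hp₀, two_mul_eq_of_cycleEigenvalue_eq_neg_two hp₀ hp₀_eq, hN, ?_⟩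
  rwa [← Multiset.cons_erase hp₀, Multiset.map_cons, hp₀_eq, Multiset.add_cons,
    Multiset.cons_inj_right, ← Finset.erase_val] at hmap

lemma spectrumOf_of_odd (hd : Odd d) : ∃ (S : Multiset ℝ) (μ : (Σ _ : Fin c, ℕ) → ℝ),
    S.card + 2 = c ∧ (∀ x ∈ S, (H k (d - 1)).eval x = -2) ∧
    (∀ p ∈ cycleIndices l,
      (H k (d - 1)).eval (μ p) = -2 * Real.cos (2 * Real.pi * (p.2 : ℝ) / (l p.1 : ℝ))) ∧
    spectrumOf (G.adjMatrix ℝ) = {(k : ℝ), -(k : ℝ)} + S + (cycleIndices l).val.map μ := by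
  obtain ⟨N, m, hm, hN, hmap⟩ := h.exists_spectrumOf_eq_of_odd hl φ hd
  obtain ⟨S, μ, rfl, hS, hμ, rfl⟩ := exists_solutions_of_map_neg_eval_H_eq hmap
  exact ⟨S, μ, hm, hS, hμ, by rw [hN, add_assoc]⟩

lemma spectrumOf_of_even (hd : Even d) :
    ∃ (S : Multiset ℝ) (μ : (Σ _ : Fin c, ℕ) → ℝ) (p₀ : Σ _ : Fin c, ℕ),
      S.card + 1 = c ∧ (∀ x ∈ S, (H k (d - 1)).eval x = -2) ∧
      p₀ ∈ cycleIndices l ∧ 2 * p₀.2 = l p₀.1 ∧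
      (∀ p ∈ (cycleIndices l).erase p₀,
        (H k (d - 1)).eval (μ p) = -2 * Real.cos (2 * Real.pi * (p.2 : ℝ) / (l p.1 : ℝ))) ∧
      spectrumOf (G.adjMatrix ℝ) =
        {(k : ℝ), -(k : ℝ)} + S + ((cycleIndices l).erase p₀).val.map μ := by
  obtain ⟨N, m, p₀, hm, hp₀, htwo, hN, hmap⟩ := h.exists_spectrumOf_eq_of_even hl φ hd
  obtain ⟨S, μ, rfl, hS, hμ, rfl⟩ := exists_solutions_of_map_neg_eval_H_eq hmap
  exact ⟨S, μ, p₀, hm, hS, hp₀, htwo, hμ, by rw [hN, add_assoc]⟩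

lemma card_filter_eval_H_of_odd (hd : Odd d) :
    ((spectrumOf (G.adjMatrix ℝ)).filter fun x => (H k (d - 1)).eval x = -2).card + 2 = c := by
  obtain ⟨N, m, hm, hN, hmap⟩ := h.exists_spectrumOf_eq_of_odd hl φ hd
  rw [h.card_filter_eval_H_eq hN hmap (two_notMem_map_cycleEigenvalue (Finset.Subset.refl _)), hm]

lemma card_filter_eval_H_of_even (hd : Even d) :
    ((spectrumOf (G.adjMatrix ℝ)).filter fun x => (H k (d - 1)).eval x = -2).card + 1 = c := by
  obtain ⟨N, m, p₀, hm, -, -, hN, hmap⟩ := h.exists_spectrumOf_eq_of_even hl φ hd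
  rw [h.card_filter_eval_H_eq hN hmap (two_notMem_map_cycleEigenvalue (Finset.erase_subset _ _)),
    hm]

end ExcessFour

end HasSmallExcess

end BipartiteExcess

theorem mainTheorem3 {V : Type*} [Fintype V] [DecidableEq V] (G : SimpleGraph V)
    [DecidableRel G.Adj] (k g d : ℕ) (hk : 6 ≤ k) (hg : 6 ≤ g) (hgd : g = 2 * d)
    (hG : BipartiteExcess.IsKGGraph G k g) (hexc : BipartiteExcess.excess V k g = 4) :
    G.IsBipartite ∧
    BipartiteExcess.excessMatrix G d = (BipartiteExcess.excessGraph G d).adjMatrix ℝ ∧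
    ∃ (c : ℕ) (l : Fin c → ℕ)
      (e : BipartiteExcess.cycleUnion l ≃g BipartiteExcess.excessGraph G d),
      (∀ i, 3 ≤ l i) ∧
      (Odd d → ∀ V₁ V₂ : Set V, G.IsBipartiteWith V₁ V₂ → V₁ ∪ V₂ = Set.univ →
        ∀ i, (∀ x : Fin (l i), e ⟨i, x⟩ ∈ V₁) ∨ (∀ x : Fin (l i), e ⟨i, x⟩ ∈ V₂)) ∧
      (Odd d → ∃ (S : Multiset ℝ) (μ : (Σ _ : Fin c, ℕ) → ℝ),
        S.card + 2 = c ∧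
        (∀ x ∈ S, (BipartiteExcess.H k (d - 1)).eval x = -2) ∧
        (∀ p ∈ BipartiteExcess.cycleIndices l, (BipartiteExcess.H k (d - 1)).eval (μ p) =
          -2 * Real.cos (2 * Real.pi * (p.2 : ℝ) / (l p.1 : ℝ))) ∧
        BipartiteExcess.spectrumOf (G.adjMatrix ℝ) =
          {(k : ℝ), -(k : ℝ)} + S + (BipartiteExcess.cycleIndices l).val.map μ) ∧
      (Even d → ∃ (S : Multiset ℝ) (μ : (Σ _ : Fin c, ℕ) → ℝ)
          (p₀ : Σ _ : Fin c, ℕ),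
        S.card + 1 = c ∧
        (∀ x ∈ S, (BipartiteExcess.H k (d - 1)).eval x = -2) ∧
        p₀ ∈ BipartiteExcess.cycleIndices l ∧ 2 * p₀.2 = l p₀.1 ∧
        (∀ p ∈ (BipartiteExcess.cycleIndices l).erase p₀,
          (BipartiteExcess.H k (d - 1)).eval (μ p) =
            -2 * Real.cos (2 * Real.pi * (p.2 : ℝ) / (l p.1 : ℝ))) ∧
        BipartiteExcess.spectrumOf (G.adjMatrix ℝ) =
          {(k : ℝ), -(k : ℝ)} + S + ((BipartiteExcess.cycleIndices l).erase p₀).val.map μ) ∧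
      (Odd d → ((BipartiteExcess.spectrumOf (G.adjMatrix ℝ)).filter
        fun x => (BipartiteExcess.H k (d - 1)).eval x = -2).card + 2 = c) ∧
      (Even d → ((BipartiteExcess.spectrumOf (G.adjMatrix ℝ)).filter
        fun x => (BipartiteExcess.H k (d - 1)).eval x = -2).card + 1 = c) := by
  subst hgd
  have h : BipartiteExcess.HasSmallExcess G k d 4 := ⟨hG, hexc, by omega, by omega⟩
  obtain ⟨c, l, φ, hl⟩ := BipartiteExcess.exists_iso_cycleUnion h.ncard_neighborSet_excessGraph
  exact ⟨h.isBipartite, BipartiteExcess.excessMatrix_eq_adjMatrix G d, c, l, φ, hl,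
    fun hd _ _ => h.cycle_subset_of_odd hd φ, h.spectrumOf_of_odd hl φ, h.spectrumOf_of_even hl φ,
    h.card_filter_eval_H_of_odd hl φ, h.card_filter_eval_H_of_even hl φ⟩
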